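/- Let $\nu$ be a place of $\mathbb{Q}$, and let $\mathbb{Q}_\infty=\mathbb{R}$. Equip the spaces $\mathbb{Q}_\nu^m$ with the Euclidean norm if $\nu=\infty$ and with the maximum norm if $\nu=p$ is a prime. Let $|\cdot|$ also denote Lebesgue measure on $\mathbb{R}^m$, respectively a Haar measure on $\mathbb{Q}_p^m$. Put $\mathcal{O}=\mathbb{Z}_p$ if $\nu=p$, and $\mathcal{O}=\mathbb{R}$ if $\nu=\infty$. *Good functions.* For $C,\alpha>0$, a Borel measurable function $g$ on an open set $V\subset\mathbb{Q}_\nu^d$, with values in $\mathbb{Q}_\nu$ or in $\mathbb{R}$, is $(C,\alpha)$-good on $V$ if for every open ball $B\subset V$ and every $\varepsilon>0$ $$\bigl|\{x\in B: |g(x)|<\varepsilon\}\bigr|\le C\Bigl(\frac{\varepsilon}{\sup_{x\in B}|g(x)|}\Bigr)^{\alpha}|B| ,$$ the condition being void for balls on which $g$ vanishes identically. *Difference quotients.* For a function $g$ of one variable and pairwise distinct points, $\Phi^0 g=g$ and $$\Phi^{k+1}g(x_1,\dots,x_{k+2})=\frac{\Phi^{k}g(x_1,x_3,\dots,x_{k+2})-\Phi^{k}g(x_2,\dots,x_{k+2})}{x_1-x_2}.$$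 For a function $g$ of $d$ variables and a multi-index $\beta=(i_1,\dots,i_d)$ put $\Phi_\beta g=\Phi_1^{i_1}\circ\dots\circ\Phi_d^{i_d}g$, where $\Phi_j^{i}$ is the quotient of order $i$ in the $j$-th variable. It is evaluated at $i_j+1$ pairwise distinct values of the $j$-th variable, $1\le j\le d$, such that all points of the resulting grid lie in the domain. Let $d\ge 1$, $n\ge 0$, let $U\subset\mathbb{Q}_\nu^{d}$ be open and $x_0\in U$. Let $f=(f^{(1)},\dots,f^{(n)}):U\to\mathbb{Q}_\nu^n$ and $\Theta:U\to\mathbb{Q}_\nu$ be analytic maps that extend analytically to the boundary of $U$. Assume that the restrictions of $1,f^{(1)},\dots,f^{(n)}$ to any nonempty open subset of $U$ are linearly independent over $\mathbb{Q}_\nu$. Assume also that for both $g=f$ and $g=\Theta$ one has, on $U$, $\|g(x)\|\le 1$, $\|\nabla g(x)\|\le 1$ (operator norm of the derivative) and $\|\Phi_\beta g\|\le \frac12$ for every multi-index $\beta$ with $|\beta|=2$. Then there exist an open neighbourhood $V\subset U$ of $x_0$, a constant $C>0$ and an integer $l\ge 2$ such that for all $(a_0,a)\in\mathcal{O}^{n+1}$: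 1. $a_0+a\cdot f+\Theta$ is $\bigl(C,\frac{1}{dl}\bigr)$-good on $V$; 2. $\|\nabla(a\cdot f+\Theta)\|$ is $\bigl(C,\frac{1}{d(l-1)}\bigr)$-good on $V$. -/

import Mathlib

open scoped ENNReal

noncomputable section

/-- `ℚ_p` carries its Borel `σ`-algebra. -/
instance Padic.instMeasurableSpaceBorel (p : ℕ) [Fact p.Prime] : MeasurableSpace ℚ_[p] :=
  borel ℚ_[p]

instance Padic.instBorelSpaceBorel (p : ℕ) [Fact p.Prime] : BorelSpace ℚ_[p] := ⟨rfl⟩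

/-- `f` is `(C, α)`-good on `V` with respect to `μ`: `f` is Borel measurable on `V` and, for every
open ball `B ⊆ V` centred in the support of `μ` and every `ε > 0`,
`μ {x ∈ B : |f x| < ε} ≤ C * (ε / sup_B |f|) ^ α * μ B`.
The arithmetic is that of `[0, ∞]`, so `ε / 0 = ∞` and the inequality is void on a ball on which
`f` vanishes identically. -/
def IsGoodOn {X E : Type*} [PseudoMetricSpace X] [MeasurableSpace X] [NormedAddCommGroup E]
    (C α : ℝ) (f : X → E) (V : Set X) (μ : MeasureTheory.Measure X) : Prop :=
  @Measurable V E _ (borel E) (fun x => f x) ∧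
  ∀ x ∈ μ.support, ∀ r : ℝ, 0 < r → Metric.ball x r ⊆ V → ∀ ε : ℝ, 0 < ε →
    μ {y ∈ Metric.ball x r | ‖f y‖ < ε} ≤
      ENNReal.ofReal C * (ENNReal.ofReal ε / ⨆ y ∈ Metric.ball x r, ‖f y‖ₑ) ^ α *
        μ (Metric.ball x r)

section Calculus

variable {𝕜 : Type*} [NontriviallyNormedField 𝕜]

/-- Difference quotients of a function of one variable: `Φ₀ f = f` and
`Φₖ₊₁ f (x₀, …, xₖ₊₁) = (Φₖ f (x₀, x₂, …, xₖ₊₁) - Φₖ f (x₁, x₂, …, xₖ₊₁)) / (x₀ - x₁)`. -/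
def diffQuot {E : Type*} [AddCommGroup E] [Module 𝕜 E] :
    (k : ℕ) → (𝕜 → E) → (Fin (k + 1) → 𝕜) → E
  | 0, f, x => f (x 0)
  | k + 1, f, x =>
      (x 0 - x 1)⁻¹ • (diffQuot k f (fun j => x (Fin.succAbove 1 j)) -
        diffQuot k f (fun j => x (Fin.succAbove 0 j)))

/-- Difference quotients of a function of `d` variables: for a multi-index `β`,
`Φ_β = Φ₁^{β₁} ∘ ⋯ ∘ Φ_d^{β_d}`, where `Φᵢ^k` is the `k`-th order difference quotient in the
`i`-th variable. The value depends on `βᵢ + 1` points `y i` for the `i`-th variable. -/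
def multiDiffQuot {E : Type*} [AddCommGroup E] [Module 𝕜 E] :
    (d : ℕ) → (β : Fin d → ℕ) → ((Fin d → 𝕜) → E) → (∀ i, Fin (β i + 1) → 𝕜) → E
  | 0, _, f, _ => f Fin.elim0
  | d + 1, β, f, y =>
      diffQuot (β 0)
        (fun t => multiDiffQuot d (fun i => β i.succ) (fun z => f (Fin.cons t z))
          (fun i => y i.succ)) (y 0)

variable {q : ℝ≥0∞} [Fact (1 ≤ q)] {d : ℕ} {E : Type*} [NormedAddCommGroup E] [NormedSpace 𝕜 E]

/-- All difference quotients `Φ_β f` of second order (`|β| = 2`) are bounded by `1/2` in norm: for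
each `i` one takes `βᵢ + 1` pairwise distinct values of the `i`-th variable, such that all points
of the resulting grid lie in `U`. -/
def SecondDiffQuotBound (f : PiLp q (fun _ : Fin d => 𝕜) → E)
    (U : Set (PiLp q (fun _ : Fin d => 𝕜))) : Prop :=
  ∀ β : Fin d → ℕ, ∑ i, β i = 2 → ∀ y : ∀ i, Fin (β i + 1) → 𝕜,
    (∀ i, Function.Injective (y i)) →
    (∀ j : ∀ i, Fin (β i + 1), WithLp.toLp q (fun i => y i (j i)) ∈ U) →
    ‖multiDiffQuot d β (fun z => f (WithLp.toLp q z)) y‖ ≤ 1 / 2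

/-- `f` is analytic on `U` and extends analytically to the boundary of `U`. -/
def AnalyticUpToBoundary {X : Type*} [NormedAddCommGroup X] [NormedSpace 𝕜 X]
    (f : X → E) (U : Set X) : Prop :=
  AnalyticOnNhd 𝕜 f U ∧ ∃ g : X → E, AnalyticOnNhd 𝕜 g (closure U) ∧ Set.EqOn f g U

/-- `‖f‖ ≤ 1` and `‖∇f‖ ≤ 1` on `U`, and second difference quotients on `U` are at most `1/2`. -/
structure NormalizedOn (f : PiLp q (fun _ : Fin d => 𝕜) → E)
    (U : Set (PiLp q (fun _ : Fin d => 𝕜))) : Prop where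
  norm_le : ∀ x ∈ U, ‖f x‖ ≤ 1
  norm_fderiv_le : ∀ x ∈ U, ‖fderiv 𝕜 f x‖ ≤ 1
  second_le : SecondDiffQuotBound f U

/-- The restrictions of `1, f₁, …, fₙ` to any nonempty open subset of `U` are linearly independent
over `𝕜`. -/
def IndependentOnOpens {X : Type*} [TopologicalSpace X] {n : ℕ}
    (f : X → PiLp q (fun _ : Fin n => 𝕜)) (U : Set X) : Prop :=
  ∀ W : Set X, IsOpen W → W.Nonempty → W ⊆ U →
    LinearIndependent 𝕜
      (Fin.cons (fun _ => 1) (fun j x => f x j) : Fin (n + 1) → (W → 𝕜))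

/-- The gradient `∇g (x) = (∂₁ g (x), …, ∂_d g (x))` of a scalar function. -/
def grad (g : PiLp q (fun _ : Fin d => 𝕜) → 𝕜) (x : PiLp q (fun _ : Fin d => 𝕜)) :
    PiLp q (fun _ : Fin d => 𝕜) :=
  WithLp.toLp q (fun i => fderiv 𝕜 g x (WithLp.toLp q (Pi.single i 1)))

end Calculus

end

/-! All functions in question are combinations `∑ c j * G j` of finitely many fixed analytic
functions: `1, Θ, f` for the first claim, and their partial derivatives in one direction for each
component of the gradient. It suffices to prove goodness of such combinations near a point with
constants independent of `c`.

Near `x₀` a combination is governed by a Taylor polynomial of a degree independent of `c`. The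
subspaces of `c` whose Taylor coefficients vanish up to degree `l` decrease with `l`, hence
stabilize, and a combination in the stable subspace vanishes near `x₀`. Modulo that subspace `c` is
bounded by finitely many Taylor coefficients, which therefore dominate the remainder
(`AnalyticAt.exists_dominating_taylor`).

After rescaling, a small cell `x + u D` carries a polynomial of bounded degree plus a small error.
Equivalence of norms on the space of such polynomials shows that, for a fixed subdivision of `D`,
the function reaches a fixed proportion of its supremum on every subcell and exceeds that proportion
everywhere on one of them (`AnalyticAt.exists_comparable_on_cells`). Discarding that subcell and
iterating makes sublevel sets decay geometrically, which is a power law with some exponent `α > 0`.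

Finally cells are compared with balls. Goodness persists for every smaller positive exponent with
the same constant, so a large `l` in the conclusion makes both `1/(dl)` and `1/(d(l-1))` admissible;
this `l` need not be the Taylor degree. -/

/-! ### Geometric decay of sublevel sets and the resulting power law. -/

open MeasureTheory in
/-- If every set of a family splits into `n` pieces of equal measure within the family, on each of
which the supremum of `h` drops by a factor at most `κ`, and on one of which `h` stays above `κ`
times the supremum, then sublevel sets of `h` decay geometrically. -/
theorem measure_sublevel_le_of_subdivision {Y ι : Type*} [MeasurableSpace Y] [Fintype ι]
    {μ : Measure Y} {h : Y → ℝ≥0∞} {𝒬 : Set (Set Y)} {κ θ : ℝ≥0∞} (hκ : κ ≤ 1)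
    (hθ : (Fintype.card ι : ℝ≥0∞) ≤ θ * (Fintype.card ι + 1)) (hθ1 : θ ≤ 1)
    (H : ∀ Q ∈ 𝒬, ∃ q : ι → Set Y, (∀ i, q i ∈ 𝒬) ∧ Q ⊆ ⋃ i, q i ∧
      (∀ i, Fintype.card ι * μ (q i) = μ Q) ∧ (∀ i, κ * ⨆ y ∈ Q, h y ≤ ⨆ y ∈ q i, h y) ∧
      ∃ i, ∀ y ∈ q i, κ * ⨆ y ∈ Q, h y ≤ h y)
    (k : ℕ) : ∀ Q ∈ 𝒬, μ {y ∈ Q | h y < κ ^ k * ⨆ y ∈ Q, h y} ≤ θ ^ k * μ Q := by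
  classical
  induction k with
  | zero =>
    intro Q _
    simpa using measure_mono (Set.sep_subset _ _)
  | succ k ih =>
    intro Q hQ
    obtain ⟨q, hq, hcov, hμ, hsup, i₀, hi₀⟩ := H Q hQ
    -- The piece `q i₀` contributes nothing. In the others one factor `κ` pays for replacing the
    -- supremum over `Q` by that over `q i`, leaving level `k`.
    have hsub : {y ∈ Q | h y < κ ^ (k + 1) * ⨆ y ∈ Q, h y} ⊆
        ⋃ i ∈ Finset.univ.erase i₀, {y ∈ q i | h y < κ ^ k * ⨆ y ∈ q i, h y} := by
      rintro y ⟨hyQ, hy⟩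
      obtain ⟨i, hi⟩ := Set.mem_iUnion.1 (hcov hyQ)
      have hne : i ≠ i₀ := by
        rintro rfl
        refine absurd hy (not_lt.2 (le_trans ?_ (hi₀ y hi)))
        gcongr
        rw [pow_succ]
        exact mul_le_of_le_one_left' (pow_le_one' hκ k)
      refine Set.mem_iUnion₂.2 ⟨i, by simp [hne], hi, hy.trans_le ?_⟩
      rw [pow_succ, mul_assoc]
      gcongr
      exact hsup i
    have hcard : 0 < Fintype.card ι := Fintype.card_pos_iff.2 ⟨i₀⟩
    have hn0 : (Fintype.card ι : ℝ≥0∞) ≠ 0 := by exact_mod_cast hcard.ne'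
    have hnt : (Fintype.card ι : ℝ≥0∞) ≠ ∞ := ENNReal.natCast_ne_top _
    -- With `n` pieces, subtract `θ ≤ 1` from `n ≤ θ (n + 1)`.
    have hθ' : ((Fintype.card ι - 1 : ℕ) : ℝ≥0∞) ≤ θ * Fintype.card ι := by
      have hθt : θ ≠ ∞ := (hθ1.trans_lt ENNReal.one_lt_top).ne
      rw [← ENNReal.add_le_add_iff_right (a := 1) (by simp)]
      calc ((Fintype.card ι - 1 : ℕ) : ℝ≥0∞) + 1 = Fintype.card ι := by
            rw [← Nat.cast_succ]; congr 1; omega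
        _ ≤ θ * Fintype.card ι + θ := by simpa [mul_add] using hθ
        _ ≤ _ := by gcongr
    calc μ {y ∈ Q | h y < κ ^ (k + 1) * ⨆ y ∈ Q, h y}
        ≤ ∑ i ∈ Finset.univ.erase i₀, μ {y ∈ q i | h y < κ ^ k * ⨆ y ∈ q i, h y} :=
          (measure_mono hsub).trans (measure_biUnion_finset_le _ _)
      _ ≤ ∑ i ∈ Finset.univ.erase i₀, θ ^ k * (μ Q / Fintype.card ι) := by
          refine Finset.sum_le_sum fun i _ => (ih _ (hq i)).trans ?_
          gcongr
          rw [ENNReal.le_div_iff_mul_le (.inl hn0) (.inl hnt), mul_comm, hμ i]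
      _ = ((Fintype.card ι - 1 : ℕ) : ℝ≥0∞) * (θ ^ k * (μ Q / Fintype.card ι)) := by
          simp [Finset.card_erase_of_mem]
      _ ≤ θ * Fintype.card ι * (θ ^ k * (μ Q / Fintype.card ι)) := by gcongr
      _ = θ ^ (k + 1) * (μ Q / Fintype.card ι * Fintype.card ι) := by ring
      _ = θ ^ (k + 1) * μ Q := by rw [ENNReal.div_mul_cancel hn0 hnt]

/-- A geometric decay rate `θ` at scales `κ ^ k` is a power law with exponent
`log θ / log κ`. -/
theorem power_bound_of_geometric_decay {F : ℝ≥0∞ → ℝ≥0∞} {S m : ℝ≥0∞} {κ θ : ℝ}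
    (hF : Monotone F) (hFm : ∀ z, F z ≤ m) (hκ0 : 0 < κ) (hκ1 : κ < 1) (hθ0 : 0 < θ) (hθ1 : θ < 1)
    (hS : S ≠ ∞)
    (H : ∀ k : ℕ, F (ENNReal.ofReal κ ^ k * S) ≤ ENNReal.ofReal θ ^ k * m) {ε : ℝ} (hε : 0 < ε) :
    F (ENNReal.ofReal ε) ≤
      ENNReal.ofReal θ⁻¹ * (ENNReal.ofReal ε / S) ^ (Real.log θ / Real.log κ) * m := by
  have hα : 0 < Real.log θ / Real.log κ :=
    div_pos_of_neg_of_neg (Real.log_neg hθ0 hθ1) (Real.log_neg hκ0 hκ1)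
  have hC : 1 ≤ ENNReal.ofReal θ⁻¹ := ENNReal.one_le_ofReal.2 ((one_le_inv₀ hθ0).2 hθ1.le)
  -- The trivial range, which includes `S = 0` because then the quotient is `∞`.
  by_cases hz : 1 ≤ ENNReal.ofReal ε / S
  · calc F (ENNReal.ofReal ε) ≤ 1 * 1 * m := by simpa using hFm _
      _ ≤ _ := by
        gcongr
        exact ENNReal.one_le_rpow hz hα
  push Not at hz
  have hS0 : S ≠ 0 := by
    rintro rfl
    rw [ENNReal.div_zero (by simpa using hε)] at hz
    simp at hz
  obtain ⟨s, hs, rfl⟩ : ∃ s : ℝ, 0 < s ∧ S = ENNReal.ofReal s :=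
    ⟨S.toReal, ENNReal.toReal_pos hS0 hS, (ENNReal.ofReal_toReal hS).symm⟩
  rw [← ENNReal.ofReal_div_of_pos hs] at hz ⊢
  have hz1 : ε / s < 1 := by simpa using hz
  have hz0 : 0 < ε / s := by positivity
  -- Here `κ ^ (k + 1) < ε / s ≤ κ ^ k`. The decay is used at level `k` and the power is bounded
  -- below at level `k + 1`; this mismatch is the constant `θ⁻¹`.
  obtain ⟨k, hk1, hk2⟩ := exists_nat_pow_near_of_lt_one hz0 hz1.le hκ0 hκ1
  calc F (ENNReal.ofReal ε) ≤ F (ENNReal.ofReal κ ^ k * ENNReal.ofReal s) := by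
        apply hF
        rw [← ENNReal.ofReal_pow hκ0.le, ← ENNReal.ofReal_mul (by positivity)]
        exact ENNReal.ofReal_le_ofReal ((div_le_iff₀ hs).1 hk2)
    _ ≤ _ := H k
    _ ≤ _ := by
        gcongr
        rw [← ENNReal.ofReal_pow hθ0.le, ENNReal.ofReal_rpow_of_pos hz0,
          ← ENNReal.ofReal_mul (by positivity)]
        apply ENNReal.ofReal_le_ofReal
        rw [← div_eq_inv_mul, le_div_iff₀ hθ0, ← pow_succ]
        have hθκ : κ ^ (Real.log θ / Real.log κ) = θ := by
          rw [Real.rpow_def_of_pos hκ0, mul_div_cancel₀ _ (Real.log_neg hκ0 hκ1).ne,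
            Real.exp_log hθ0]
        calc θ ^ (k + 1) = (κ ^ (k + 1)) ^ (Real.log θ / Real.log κ) := by
              rw [← Real.rpow_natCast, ← Real.rpow_natCast, ← Real.rpow_mul hκ0.le, mul_comm,
                Real.rpow_mul hκ0.le, hθκ]
          _ ≤ _ := by gcongr

/-! ### Polynomials of bounded degree and equivalence of norms. -/

/-- Multi-indices `β ∈ ℕ^d` of total degree at most `l`. -/
def multiIndices (d l : ℕ) : Finset (Fin d → ℕ) :=
  (Fintype.piFinset fun _ => Finset.range (l + 1)).filter fun β => ∑ i, β i ≤ l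

theorem mem_multiIndices {d l : ℕ} {β : Fin d → ℕ} : β ∈ multiIndices d l ↔ ∑ i, β i ≤ l := by
  simp only [multiIndices, Finset.mem_filter, Fintype.mem_piFinset, Finset.mem_range,
    and_iff_right_iff_imp]
  intro h i
  exact Nat.lt_succ_of_le ((Finset.single_le_sum (fun _ _ => Nat.zero_le _) (Finset.mem_univ i)).trans h)

section Polynomials

variable {𝕜 : Type*} [NontriviallyNormedField 𝕜] {d l : ℕ}

/-- The polynomial `∑ b_β t^β` of degree at most `l`, linearly in its coefficients. -/
def polyEval (d l : ℕ) (t : Fin d → 𝕜) : (multiIndices d l → 𝕜) →ₗ[𝕜] 𝕜 where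
  toFun b := ∑ β, b β * ∏ i, t i ^ β.1 i
  map_add' := by intros; simp [add_mul, Finset.sum_add_distrib]
  map_smul' := by intros; simp [Finset.mul_sum, mul_assoc]

theorem polyEval_apply (t : Fin d → 𝕜) (b : multiIndices d l → 𝕜) :
    polyEval d l t b = ∑ β, b β * ∏ i, t i ^ β.1 i := rfl

theorem continuous_polyEval (b : multiIndices d l → 𝕜) : Continuous fun t => polyEval d l t b := by
  simp only [polyEval_apply]
  fun_prop

/-- A ball for the maximum norm is a product of infinite sets, and a polynomial vanishing on such a
product is zero. -/
theorem eq_zero_of_polyEval_eq_zero {x : Fin d → 𝕜} {r : ℝ} (hr : 0 < r)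
    {b : multiIndices d l → 𝕜} (h : ∀ t ∈ Metric.closedBall x r, polyEval d l t b = 0) : b = 0 := by
  classical
  let e : (Fin d → ℕ) ≃ (Fin d →₀ ℕ) := Finsupp.equivFunOnFinite.symm
  let p : MvPolynomial (Fin d) 𝕜 := ∑ β, MvPolynomial.monomial (e β.1) (b β)
  have hp : ∀ t, MvPolynomial.eval t p = polyEval d l t b := by
    intro t
    simp only [p, map_sum, MvPolynomial.eval_monomial, polyEval_apply]
    refine Finset.sum_congr rfl fun β _ => ?_
    rw [Finsupp.prod_fintype _ _ (by simp)]
    simp [e]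
  have h0 : p = 0 := by
    refine MvPolynomial.funext_set (fun i => Metric.closedBall (x i) r) (fun i => ?_) ?_
    · exact infinite_of_mem_nhds (x i) (Metric.closedBall_mem_nhds _ hr)
    · intro t ht
      rw [hp, map_zero]
      refine h t ?_
      rw [closedBall_pi _ hr.le]
      exact ht
  funext β
  have := congrArg (MvPolynomial.coeff (e β.1)) h0
  simp only [p, MvPolynomial.coeff_sum, MvPolynomial.coeff_monomial, MvPolynomial.coeff_zero,
    e.injective.eq_iff] at this
  rw [Finset.sum_eq_single β] at this
  · simpa using this
  · intro γ _ hγ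
    rw [if_neg]
    exact fun h => hγ (Subtype.ext h)
  · simp

/-- The coefficients of a polynomial are controlled by its values on a set with nonempty
interior. -/
theorem exists_norm_coeff_le [CompleteSpace 𝕜] [ProperSpace 𝕜] {S : Set (Fin d → 𝕜)}
    (hS : (interior S).Nonempty) :
    ∃ c : ℝ, 0 < c ∧ ∀ b : multiIndices d l → 𝕜, ∃ t ∈ S, c * ‖b‖ ≤ ‖polyEval d l t b‖ := by
  obtain ⟨x, hx⟩ := hS
  obtain ⟨r, hr, hrS⟩ := Metric.nhds_basis_closedBall.mem_iff.1 (mem_interior_iff_mem_nhds.1 hx)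
  let K : Set (Fin d → 𝕜) := Metric.closedBall x r
  have : CompactSpace K := isCompact_iff_compactSpace.1 (isCompact_closedBall x r)
  have : Nonempty K := ⟨⟨x, Metric.mem_closedBall_self hr.le⟩⟩
  let L : (multiIndices d l → 𝕜) →ₗ[𝕜] C(K, 𝕜) :=
    { toFun := fun b => ⟨fun t => polyEval d l t.1 b, (continuous_polyEval b).comp continuous_subtype_val⟩
      map_add' := by intros; ext; simp
      map_smul' := by intros; ext; simp }
  have hL : LinearMap.ker L = ⊥ := by
    refine LinearMap.ker_eq_bot'.2 fun b hb => eq_zero_of_polyEval_eq_zero (x := x) hr fun t ht => ?_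
    exact DFunLike.congr_fun hb (⟨t, ht⟩ : K)
  -- An injective linear map from a finite-dimensional space over a complete field is bounded below;
  -- compactness of `K` then makes the sup norm a value at a point.
  obtain ⟨C, hC, hLC⟩ := L.injective_iff_antilipschitz.1 (LinearMap.ker_eq_bot.1 hL)
  refine ⟨(C : ℝ)⁻¹, by positivity, fun b => ?_⟩
  obtain ⟨t, ht⟩ : ∃ t, ‖L b t‖ = ‖L b‖ := by
    obtain ⟨t, -, ht⟩ := isCompact_univ.exists_isMaxOn (s := (Set.univ : Set K)) Set.univ_nonempty
      (L b).continuous.norm.continuousOn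
    exact ⟨t, le_antisymm ((L b).norm_coe_le_norm t)
      (((L b).norm_le (norm_nonneg _)).2 fun s => ht (Set.mem_univ s))⟩
  refine ⟨t.1, hrS t.2, ?_⟩
  have h1 : ‖b‖ ≤ C * ‖L b‖ := by simpa using hLC.le_mul_norm_sub b 0
  rw [inv_mul_le_iff₀ (by positivity)]
  rwa [← ht] at h1

/-- Polynomials of bounded degree are equicontinuous on bounded sets, relative to the size of their
coefficients. -/
theorem exists_norm_polyEval_sub_le [ProperSpace 𝕜] (d l : ℕ) (R : ℝ) {η : ℝ} (hη : 0 < η) :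
    ∃ δ : ℝ, 0 < δ ∧ ∀ t ∈ Metric.closedBall (0 : Fin d → 𝕜) R,
      ∀ t' ∈ Metric.closedBall (0 : Fin d → 𝕜) R, dist t t' < δ →
      ∀ b : multiIndices d l → 𝕜, ‖polyEval d l t b - polyEval d l t' b‖ ≤ η * ‖b‖ := by
  let M : (Fin d → 𝕜) → (multiIndices d l → 𝕜) := fun t β => ∏ i, t i ^ β.1 i
  have hM : Continuous M := by fun_prop
  have hU := (isCompact_closedBall (0 : Fin d → 𝕜) R).uniformContinuousOn_of_continuous hM.continuousOn
  obtain ⟨δ, hδ, H⟩ := Metric.uniformContinuousOn_iff.1 hU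
    (η / (Fintype.card (multiIndices d l) + 1)) (by positivity)
  refine ⟨δ, hδ, fun t ht t' ht' htt b => ?_⟩
  have h1 := (H t ht t' ht' htt).le
  rw [dist_eq_norm] at h1
  have : polyEval d l t b - polyEval d l t' b = ∑ β, b β * (M t - M t') β := by
    simp [polyEval_apply, M, mul_sub]
  rw [this]
  calc _ ≤ ∑ β, ‖b β * (M t - M t') β‖ := norm_sum_le _ _
    _ ≤ ∑ β : multiIndices d l, ‖b‖ * (η / (Fintype.card (multiIndices d l) + 1)) := by
        refine Finset.sum_le_sum fun β _ => ?_
        rw [norm_mul]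
        gcongr
        · exact norm_le_pi_norm b β
        · exact (norm_le_pi_norm _ β).trans h1
    _ = (Fintype.card (multiIndices d l) / (Fintype.card (multiIndices d l) + 1)) * (η * ‖b‖) := by
        rw [Finset.sum_const, Finset.card_univ, nsmul_eq_mul]; ring
    _ ≤ 1 * (η * ‖b‖) := by
        gcongr
        rw [div_le_one (by positivity)]
        linarith
    _ = _ := one_mul _

theorem exists_norm_polyEval_le [ProperSpace 𝕜] (d l : ℕ) (R : ℝ) :
    ∃ C : ℝ, 0 < C ∧ ∀ t ∈ Metric.closedBall (0 : Fin d → 𝕜) R,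
      ∀ b : multiIndices d l → 𝕜, ‖polyEval d l t b‖ ≤ C * ‖b‖ := by
  let M : (Fin d → 𝕜) → (multiIndices d l → 𝕜) := fun t β => ∏ i, t i ^ β.1 i
  have hM : Continuous M := by fun_prop
  obtain ⟨B, hB⟩ := (isCompact_closedBall (0 : Fin d → 𝕜) R).exists_bound_of_continuousOn
    hM.continuousOn
  refine ⟨Fintype.card (multiIndices d l) * |B| + 1, by positivity, fun t ht b => ?_⟩
  rw [polyEval_apply]
  calc _ ≤ ∑ β : multiIndices d l, ‖b β * M t β‖ := norm_sum_le _ _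
    _ ≤ ∑ β : multiIndices d l, ‖b‖ * |B| := by
        refine Finset.sum_le_sum fun β _ => ?_
        rw [norm_mul]
        gcongr
        · exact norm_le_pi_norm b β
        · exact ((norm_le_pi_norm _ β).trans (hB t ht)).trans (le_abs_self B)
    _ = (Fintype.card (multiIndices d l) * |B|) * ‖b‖ := by
        rw [Finset.sum_const, Finset.card_univ, nsmul_eq_mul]; ring
    _ ≤ _ := by gcongr; linarith

end Polynomials

/-! ### Taylor expansion with uniform remainder, and its monomial form. -/

section Taylor

open scoped NNReal
open Topology

/-- Taylor expansion at nearby points, with a remainder that is uniform in the base point. -/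
theorem AnalyticAt.exists_uniform_taylor {𝕜 E F : Type*} [NontriviallyNormedField 𝕜]
    [NormedAddCommGroup E] [NormedSpace 𝕜 E] [NormedAddCommGroup F] [NormedSpace 𝕜 F]
    [CompleteSpace F] {G : E → F} {x₀ : E} (hG : AnalyticAt 𝕜 G x₀) :
    ∃ q : E → FormalMultilinearSeries 𝕜 E F, (∀ k, ContinuousAt (fun x => q x k) x₀) ∧
      ∃ ρ : ℝ, 0 < ρ ∧ ∃ M : ℝ, 0 ≤ M ∧ ∀ x ∈ Metric.ball x₀ ρ, ∀ w, ‖w‖ < ρ → ∀ l : ℕ,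
        ‖G (x + w) - ∑ k ∈ Finset.range (l + 1), q x k fun _ => w‖ ≤ M * (‖w‖ / ρ) ^ (l + 1) := by
  obtain ⟨p, r, hp⟩ := hG
  obtain ⟨r₁, hr₁0, hr₁⟩ := ENNReal.lt_iff_exists_nnreal_btwn.1 hp.r_pos
  have hr₁0' : 0 < r₁ := by exact_mod_cast hr₁0
  -- The base point moves by at most `ρ` and the re-expanded series is bounded at radius `2ρ`, so
  -- `3ρ` must stay inside the radius of convergence. For `‖w‖ < ρ` the terms then decay with ratio
  -- at most `1/2`.
  set ρ : ℝ≥0 := r₁ / 4 with hρ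
  have hρ0 : 0 < ρ := by positivity
  have h3 : ((ρ : ℝ≥0∞) + (2 * ρ : ℝ≥0)) < p.radius := by
    refine lt_of_lt_of_le (lt_of_le_of_lt ?_ hr₁) hp.r_le
    norm_cast
    rw [hρ, ← NNReal.coe_le_coe]
    push_cast
    linarith [r₁.2]
  have hsum := p.changeOriginSeries_summable_aux₁ h3
  set M : ℝ≥0 := ∑' s : Σ k l : ℕ, { s : Finset (Fin (k + l)) // s.card = l },
    ‖p (s.1 + s.2.1)‖₊ * ρ ^ s.2.1 * (2 * ρ) ^ s.1 with hM
  -- Cauchy-type estimates uniform in `y`: each left side is dominated by a part of the double sum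
  -- `M`.
  have hbound : ∀ y : E, ‖y‖₊ ≤ ρ → ∀ k, ‖p.changeOrigin y k‖₊ * (2 * ρ) ^ k ≤ M := by
    intro y hy k
    have hρr : (ρ : ℝ≥0∞) < p.radius := lt_of_le_of_lt le_self_add h3
    have hyr : (‖y‖₊ : ℝ≥0∞) < p.radius := lt_of_le_of_lt (by exact_mod_cast hy) hρr
    have hs := NNReal.summable_sigma.1 hsum
    calc ‖p.changeOrigin y k‖₊ * (2 * ρ) ^ k
        ≤ (∑' s : Σ l : ℕ, { s : Finset (Fin (k + l)) // s.card = l },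
            ‖p (k + s.1)‖₊ * ‖y‖₊ ^ s.1) * (2 * ρ) ^ k := by
          gcongr; exact p.nnnorm_changeOrigin_le k hyr
      _ ≤ (∑' s : Σ l : ℕ, { s : Finset (Fin (k + l)) // s.card = l },
            ‖p (k + s.1)‖₊ * ρ ^ s.1) * (2 * ρ) ^ k := by
          gcongr ?_ * _
          refine Summable.tsum_le_tsum (fun s => by gcongr)
            (p.changeOriginSeries_summable_aux₂ hyr k) (p.changeOriginSeries_summable_aux₂ hρr k)
      _ = ∑' s : Σ l : ℕ, { s : Finset (Fin (k + l)) // s.card = l },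
            ‖p (k + s.1)‖₊ * ρ ^ s.1 * (2 * ρ) ^ k := (NNReal.tsum_mul_right _ _).symm
      _ ≤ M := by
          rw [hM, hsum.tsum_sigma' hs.1]
          exact hs.2.le_tsum k fun _ _ => zero_le
  refine ⟨fun x => p.changeOrigin (x - x₀), fun k => ?_, ρ, by exact_mod_cast hρ0, 2 * M,
    by positivity, fun x hx w hw l => ?_⟩
  · have h1 := (p.analyticAt_changeOrigin hp.radius_pos k).continuousAt
    have h2 : ContinuousAt (fun x : E => x - x₀) x₀ := by fun_prop
    exact ContinuousAt.comp (g := fun x => p.changeOrigin x k) (by simpa using h1) h2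
  have hy : ‖x - x₀‖₊ ≤ ρ := by
    rw [mem_ball_iff_norm] at hx
    exact_mod_cast hx.le
  have hS : HasSum (fun k => p.changeOrigin (x - x₀) k fun _ => w) (G (x + w)) := by
    have hyr : ‖x - x₀‖ₑ + ‖w‖ₑ < r := by
      calc ‖x - x₀‖ₑ + ‖w‖ₑ ≤ ρ + ρ := by
            gcongr
            · exact_mod_cast hy
            · exact_mod_cast hw.le
        _ ≤ r₁ := by
            norm_cast
            rw [hρ, ← NNReal.coe_le_coe]
            push_cast
            linarith [r₁.2]
        _ < r := hr₁
    have := (hp.changeOrigin (y := x - x₀) (lt_of_le_of_lt le_self_add hyr)).hasSum (y := w) (by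
      rw [mem_eball_zero_iff, lt_tsub_iff_right, add_comm]
      exact hyr)
    simpa using this
  have hρ' : (0 : ℝ) < ρ := by exact_mod_cast hρ0
  have hgeo : ∀ k, ‖p.changeOrigin (x - x₀) k fun _ => w‖ ≤ M * (‖w‖ / (2 * ρ)) ^ k := by
    intro k
    refine ((p.changeOrigin (x - x₀) k).le_opNorm _).trans ?_
    rw [Finset.prod_const, Finset.card_univ, Fintype.card_fin, div_pow, mul_div_assoc',
      le_div_iff₀ (by positivity), mul_right_comm]
    gcongr
    exact_mod_cast hbound _ hy k
  have hratio : ‖w‖ / (2 * ρ) ≤ 1 / 2 := by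
    rw [div_le_div_iff₀ (by positivity) (by norm_num)]; linarith
  have := norm_sub_le_of_geometric_bound_of_hasSum (lt_of_le_of_lt hratio (by norm_num)) hgeo hS
    (l + 1)
  rw [norm_sub_rev]
  refine this.trans ?_
  rw [div_le_iff₀ (by linarith)]
  calc M * (‖w‖ / (2 * ρ)) ^ (l + 1) ≤ M * (‖w‖ / ρ) ^ (l + 1) := by
        gcongr
        linarith
    _ = 2 * M * (‖w‖ / ρ) ^ (l + 1) * (1 / 2) := by ring
    _ ≤ _ := by
        gcongr
        linarith

variable {𝕜 : Type*} [NontriviallyNormedField 𝕜] {d : ℕ} {F : Type*} [NormedAddCommGroup F]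
  [NormedSpace 𝕜 F]

/-- The coefficient of `w^β` in the polynomial `w ↦ q |β| (w, …, w)`. -/
def FormalMultilinearSeries.monomialCoeff (q : FormalMultilinearSeries 𝕜 (Fin d → 𝕜) F)
    (β : Fin d → ℕ) : F :=
  ∑ f : Fin (∑ i, β i) → Fin d with (fun i => Finset.card {k | f k = i}) = β,
    q (∑ i, β i) fun k => Pi.single (f k) 1

/-- Expand `w` in the standard basis by multilinearity and group the index maps `Fin k → Fin d` by
the sizes of their fibres. -/
theorem FormalMultilinearSeries.sum_range_eq_sum_monomialCoeff
    (q : FormalMultilinearSeries 𝕜 (Fin d → 𝕜) F) (l : ℕ) (w : Fin d → 𝕜) :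
    ∑ k ∈ Finset.range (l + 1), q k (fun _ => w) =
      ∑ β ∈ multiIndices d l, (∏ i, w i ^ β i) • q.monomialCoeff β := by
  classical
  have hmaps : ∀ β ∈ multiIndices d l, ∑ i, β i ∈ Finset.range (l + 1) := fun β hβ =>
    Finset.mem_range.2 (Nat.lt_succ_of_le (mem_multiIndices.1 hβ))
  rw [← Finset.sum_fiberwise_of_maps_to hmaps]
  refine Finset.sum_congr rfl fun k hk => ?_
  have hw : w = ∑ i, w i • (Pi.single i 1 : Fin d → 𝕜) := by
    funext j; simp [Finset.sum_apply, Pi.single_apply]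
  have hcnt : ∀ f ∈ (Finset.univ : Finset (Fin k → Fin d)),
      (fun i => Finset.card {a | f a = i}) ∈ (multiIndices d l).filter fun β => ∑ i, β i = k := by
    intro f _
    have : ∑ i, Finset.card {a | f a = i} = k := by
      rw [← Finset.card_eq_sum_card_fiberwise (fun _ _ => Finset.mem_coe.2 (Finset.mem_univ _))]
      simp
    simp only [Finset.mem_filter, mem_multiIndices, this, and_true]
    exact Nat.lt_succ_iff.1 (Finset.mem_range.1 hk)
  calc q k (fun _ => w) = q k (fun _ => ∑ i, w i • (Pi.single i 1 : Fin d → 𝕜)) := by rw [← hw]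
    _ = ∑ f : Fin k → Fin d, (∏ a, w (f a)) • q k (fun a => Pi.single (f a) 1) := by
        rw [ContinuousMultilinearMap.map_sum]
        exact Finset.sum_congr rfl fun f _ => ContinuousMultilinearMap.map_smul_univ _ _ _
    _ = _ := by
        rw [← Finset.sum_fiberwise_of_maps_to hcnt]
        refine Finset.sum_congr rfl fun β hβ => ?_
        obtain rfl := (Finset.mem_filter.1 hβ).2
        rw [FormalMultilinearSeries.monomialCoeff, Finset.smul_sum]
        refine Finset.sum_congr rfl fun f hf => ?_
        congr 1
        rw [Finset.prod_comp w f]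
        have hf' := (Finset.mem_filter.1 hf).2
        rw [Finset.prod_subset (Finset.subset_univ _)]
        · refine Finset.prod_congr rfl fun i _ => ?_
          rw [← congrFun hf' i]
        · intro i _ hi
          rw [Finset.card_eq_zero.2, pow_zero]
          simpa [Finset.filter_eq_empty_iff] using hi

end Taylor

/-! ### Taylor polynomials dominating the remainder uniformly in the coefficients. -/

section Nondegenerate

open Topology

variable {𝕜 : Type*} [NontriviallyNormedField 𝕜] {d m : ℕ}

theorem norm_sum_mul_le (c v : Fin m → 𝕜) : ‖∑ j, c j * v j‖ ≤ m * (‖c‖ * ‖v‖) := by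
  calc ‖∑ j, c j * v j‖ ≤ ∑ j, ‖c j * v j‖ := norm_sum_le _ _
    _ ≤ ∑ _j : Fin m, ‖c‖ * ‖v‖ := by
        refine Finset.sum_le_sum fun j _ => ?_
        rw [norm_mul]
        gcongr
        · exact norm_le_pi_norm c j
        · exact norm_le_pi_norm v j
    _ = _ := by simp

/-- Every vector has the same image as some vector whose norm is controlled by that image. -/
theorem LinearMap.exists_norm_le_of_same_image [CompleteSpace 𝕜] {E F : Type*}
    [NormedAddCommGroup E] [NormedSpace 𝕜 E] [NormedAddCommGroup F] [NormedSpace 𝕜 F]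
    [FiniteDimensional 𝕜 E] (L : E →ₗ[𝕜] F) :
    ∃ C : ℝ, 0 < C ∧ ∀ c, ∃ c', L c' = L c ∧ ‖c'‖ ≤ C * ‖L c'‖ := by
  obtain ⟨S, hS⟩ := L.rangeRestrict.exists_rightInverse_of_surjective L.range_rangeRestrict
  obtain ⟨C, hC, hSC⟩ := (LinearMap.toContinuousLinearMap S).bound
  refine ⟨C, hC, fun c => ⟨S (L.rangeRestrict c), ?_, ?_⟩⟩
  · exact congrArg Subtype.val (LinearMap.congr_fun hS (L.rangeRestrict c))
  · have h : L (S (L.rangeRestrict c)) = L c :=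
      congrArg Subtype.val (LinearMap.congr_fun hS (L.rangeRestrict c))
    rw [h]
    exact hSC (L.rangeRestrict c)

/-- Linear combinations of analytic functions have Taylor polynomials of a fixed degree, near any
given point, which dominate the remainder uniformly in the coefficients and the base point. -/
theorem AnalyticAt.exists_dominating_taylor [CompleteSpace 𝕜] {G : (Fin d → 𝕜) → Fin m → 𝕜}
    {x₀ : Fin d → 𝕜} (hG : AnalyticAt 𝕜 G x₀) :
    ∃ l : ℕ, ∃ ρ : ℝ, 0 < ρ ∧ ∃ K : ℝ, 0 ≤ K ∧ ∀ c : Fin m → 𝕜, ∀ x ∈ Metric.ball x₀ ρ,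
      ∃ b : multiIndices d l → 𝕜, ∀ w, ‖w‖ < ρ →
        ‖∑ j, c j * G (x + w) j - polyEval d l w b‖ ≤ K * ‖b‖ * ‖w‖ ^ (l + 1) := by
  obtain ⟨q, hq, ρ, hρ, M, hM, hrem⟩ := hG.exists_uniform_taylor
  set B : (Fin d → ℕ) → (Fin d → 𝕜) → Fin m → 𝕜 := fun β x => (q x).monomialCoeff β with hB
  have hBc : ∀ β, ContinuousAt (B β) x₀ := by
    intro β
    refine tendsto_finsetSum _ fun f _ => ?_
    have h := hq (∑ i, β i)
    exact ((ContinuousMultilinearMap.apply 𝕜 (fun _ => Fin d → 𝕜) (Fin m → 𝕜)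
      fun k => Pi.single (f k) 1).continuous.tendsto _).comp h
  -- This remainder is measured by `‖c‖`. What is left is to replace `‖c‖` by the size of the Taylor
  -- coefficients.
  have hrem' : ∀ c : Fin m → 𝕜, ∀ x ∈ Metric.ball x₀ ρ, ∀ w, ‖w‖ < ρ → ∀ l,
      ‖∑ j, c j * G (x + w) j - polyEval d l w fun β => ∑ j, c j * B β.1 x j‖ ≤
        m * (‖c‖ * (M * (‖w‖ / ρ) ^ (l + 1))) := by
    intro c x hx w hw l
    have h1 := hrem x hx w hw l
    rw [FormalMultilinearSeries.sum_range_eq_sum_monomialCoeff] at h1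
    refine le_trans (le_of_eq ?_) ((norm_sum_mul_le c _).trans (by gcongr))
    congr 1
    simp only [Pi.sub_apply, mul_sub, Finset.sum_sub_distrib, Finset.sum_apply, Pi.smul_apply,
      smul_eq_mul, polyEval_apply, Finset.mul_sum, Finset.sum_mul]
    congr 1
    rw [Finset.sum_comm]
    refine Finset.sum_congr rfl fun j _ => ?_
    rw [← Finset.sum_coe_sort (multiIndices d l)]
    refine Finset.sum_congr rfl fun β _ => ?_
    simp only [hB]
    ring
  let L : ∀ l : ℕ, (Fin m → 𝕜) →ₗ[𝕜] (multiIndices d l → 𝕜) := fun l =>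
    { toFun := fun c β => ∑ j, c j * B β.1 x₀ j
      map_add' := by intros; funext; simp [add_mul, Finset.sum_add_distrib]
      map_smul' := by intros; funext; simp [Finset.mul_sum, mul_assoc] }
  have hanti : ∀ l l', l ≤ l' → LinearMap.ker (L l') ≤ LinearMap.ker (L l) := by
    intro l l' hl c hc
    rw [LinearMap.mem_ker] at hc ⊢
    funext β
    exact congrFun hc ⟨β.1, mem_multiIndices.2 ((mem_multiIndices.1 β.2).trans hl)⟩
  -- The descending chain condition in `𝕜^m` fixes the degree; the order dual turns the decreasing
  -- kernels into a monotone sequence.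
  obtain ⟨l, hl⟩ := IsArtinian.monotone_stabilizes
    (⟨fun l => LinearMap.ker (L l), fun l l' h => hanti l l' h⟩ : ℕ →o (Submodule 𝕜 (Fin m → 𝕜))ᵒᵈ)
  -- By stabilization all Taylor polynomials at `x₀` of degree at least `l` vanish, so the function
  -- equals its remainder, which tends to zero as the degree grows.
  have hker : ∀ c, L l c = 0 → ∀ y ∈ Metric.ball x₀ ρ, ∑ j, c j * G y j = 0 := by
    intro c hc y hy
    have hw : ‖y - x₀‖ < ρ := by rwa [← mem_ball_iff_norm]
    have hlim : Filter.Tendsto (fun n : ℕ => m * (‖c‖ * (M * (‖y - x₀‖ / ρ) ^ (n + 1))))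
        Filter.atTop (𝓝 (m * (‖c‖ * (M * 0)))) := by
      refine ((((tendsto_pow_atTop_nhds_zero_of_lt_one (by positivity)
        ((div_lt_one hρ).2 hw)).comp (Filter.tendsto_add_atTop_nat 1)).const_mul M).const_mul
          ‖c‖).const_mul (m : ℝ)
    rw [← norm_le_zero_iff]
    refine ge_of_tendsto (by simpa using hlim) ?_
    filter_upwards [Filter.eventually_ge_atTop l] with n hn
    have h0 : L n c = 0 := by
      have : c ∈ LinearMap.ker (L l) := hc
      have e : LinearMap.ker (L l) = LinearMap.ker (L n) := hl n hn
      rw [e] at this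
      exact this
    have h := hrem' c x₀ (Metric.mem_ball_self hρ) (y - x₀) hw n
    have h0' : (fun β : multiIndices d n => ∑ j, c j * B β.1 x₀ j) = 0 := h0
    rw [h0', map_zero, sub_zero, add_sub_cancel] at h
    exact h
  obtain ⟨C, hC, hLC⟩ := (L l).exists_norm_le_of_same_image
  -- The tolerance is chosen so that moving the base point from `x₀` to `x` costs at most `‖c'‖ / 2`
  -- in `‖c'‖ ≤ C ‖L l c'‖`. Absorbing this gives `‖c'‖ ≤ 2 C ‖b‖`.
  have hnear : ∀ᶠ x in 𝓝 x₀, ∀ β : multiIndices d l, ‖B β.1 x - B β.1 x₀‖ ≤ 1 / (2 * C * (m + 1)) := by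
    rw [Filter.eventually_all]
    intro β
    have h := (hBc β.1).sub_const (B β.1 x₀) |>.norm
    filter_upwards [h.eventually_lt_const (u := 1 / (2 * C * (m + 1)))
      (by rw [sub_self, norm_zero]; positivity)] with x hx using hx.le
  obtain ⟨ρ', hρ', hnear'⟩ := Metric.eventually_nhds_iff_ball.1 hnear
  refine ⟨l, min ρ' (ρ / 2), by positivity, m * (2 * C) * (M / ρ ^ (l + 1)), by positivity,
    fun c x hx => ?_⟩
  obtain ⟨c', hc', hc'C⟩ := hLC c
  have hx1 : x ∈ Metric.ball x₀ ρ' := Metric.ball_subset_ball (min_le_left _ _) hx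
  have hx2 : x ∈ Metric.ball x₀ (ρ / 2) := Metric.ball_subset_ball (min_le_right _ _) hx
  set b : multiIndices d l → 𝕜 := fun β => ∑ j, c' j * B β.1 x j with hb
  have hdiff : ‖L l c' - b‖ ≤ m * (‖c'‖ * (1 / (2 * C * (m + 1)))) := by
    refine (pi_norm_le_iff_of_nonneg (by positivity)).2 fun β => ?_
    have e : (L l c' - b) β = ∑ j, c' j * (B β.1 x₀ - B β.1 x) j := by
      simp [L, hb, mul_sub]
    rw [e]
    refine (norm_sum_mul_le _ _).trans ?_
    gcongr
    rw [norm_sub_rev]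
    exact hnear' x hx1 β
  have hcb : ‖c'‖ ≤ 2 * C * ‖b‖ := by
    have h1 : ‖L l c'‖ ≤ ‖b‖ + m * (‖c'‖ * (1 / (2 * C * (m + 1)))) :=
      (norm_le_norm_add_norm_sub' _ b).trans (by gcongr)
    have h2 : C * (m * (‖c'‖ * (1 / (2 * C * (m + 1))))) ≤ ‖c'‖ / 2 := by
      have e : C * (m * (‖c'‖ * (1 / (2 * C * (m + 1))))) = ‖c'‖ / 2 * (m / (m + 1)) := by
        field_simp
      rw [e]
      refine mul_le_of_le_one_right (by positivity) ?_
      rw [div_le_one (by positivity)]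
      linarith
    have h3 := mul_le_mul_of_nonneg_left h1 hC.le
    linarith
  refine ⟨b, fun w hw => ?_⟩
  have hw2 : ‖w‖ < ρ / 2 := hw.trans_le (min_le_right _ _)
  have hxw : x + w ∈ Metric.ball x₀ ρ := by
    rw [mem_ball_iff_norm] at hx2 ⊢
    calc ‖x + w - x₀‖ = ‖(x - x₀) + w‖ := by congr 1; abel
      _ ≤ _ := norm_add_le _ _
      _ < ρ := by linarith
  -- Changing `c` by an element of the stable kernel does not change the function.
  have hcc : ∑ j, c j * G (x + w) j = ∑ j, c' j * G (x + w) j := by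
    have h := hker (c' - c) (by rw [map_sub, hc', sub_self]) _ hxw
    simp only [Pi.sub_apply, sub_mul, Finset.sum_sub_distrib] at h
    exact (sub_eq_zero.1 h).symm
  rw [hcc]
  refine (hrem' c' x (Metric.ball_subset_ball (by linarith) hx2) w (by linarith) l).trans ?_
  calc m * (‖c'‖ * (M * (‖w‖ / ρ) ^ (l + 1)))
      ≤ m * (2 * C * ‖b‖ * (M * (‖w‖ / ρ) ^ (l + 1))) := by gcongr
    _ = _ := by rw [div_pow]; ring

end Nondegenerate

/-! ### Self-similar sets, cells and their subdivision. -/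

section SelfSimilar

open MeasureTheory

/-- A bounded measurable set with nonempty interior which is, at arbitrarily small scales `s`, a
disjoint union of finitely many translates of its `s`-multiple. -/
structure IsSelfSimilar (𝕜 : Type*) [NontriviallyNormedField 𝕜] {E : Type*} [NormedAddCommGroup E]
    [NormedSpace 𝕜 E] [MeasurableSpace E] (D : Set E) : Prop where
  zero_mem : (0 : E) ∈ D
  measurableSet : MeasurableSet D
  isBounded : Bornology.IsBounded D
  interior_nonempty : (interior D).Nonempty
  exists_partition : ∀ η : ℝ, 0 < η → ∃ s : 𝕜, s ≠ 0 ∧ ‖s‖ < η ∧ ∃ A : Finset E,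
    (∀ a ∈ A, ∀ t ∈ D, a + s • t ∈ D) ∧ (∀ t ∈ D, ∃ a ∈ A, ∃ t' ∈ D, a + s • t' = t) ∧
    ∀ a ∈ A, ∀ a' ∈ A, ∀ t ∈ D, ∀ t' ∈ D, a + s • t = a' + s • t' → a = a'

/-- The translated and rescaled copy `x + u D` of `D`. -/
def cell {𝕜 E : Type*} [SMul 𝕜 E] [Add E] (D : Set E) (x : E) (u : 𝕜) : Set E :=
  (fun t => x + u • t) '' D

variable {𝕜 : Type*} [NontriviallyNormedField 𝕜]

theorem IsSelfSimilar.pi [MeasurableSpace 𝕜] {D : Set 𝕜} (hD : IsSelfSimilar 𝕜 D) (d : ℕ) :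
    IsSelfSimilar 𝕜 (Set.pi Set.univ fun _ : Fin d => D) where
  zero_mem := fun _ _ => hD.zero_mem
  measurableSet := MeasurableSet.univ_pi fun _ => hD.measurableSet
  isBounded := Bornology.IsBounded.pi fun _ => hD.isBounded
  interior_nonempty := by
    rw [interior_pi_set Set.finite_univ]
    exact Set.univ_pi_nonempty_iff.2 fun _ => hD.interior_nonempty
  exists_partition := by
    classical
    intro η hη
    obtain ⟨s, hs0, hs, A, h1, h2, h3⟩ := hD.exists_partition η hη
    refine ⟨s, hs0, hs, Fintype.piFinset fun _ => A, ?_, ?_, ?_⟩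
    · intro a ha t ht i _
      exact h1 _ (Fintype.mem_piFinset.1 ha i) _ (ht i trivial)
    · intro t ht
      choose a ha t' ht' h using fun i => h2 (t i) (ht i trivial)
      exact ⟨a, Fintype.mem_piFinset.2 ha, t', fun i _ => ht' i, funext h⟩
    · intro a ha a' ha' t ht t' ht' h
      funext i
      exact h3 _ (Fintype.mem_piFinset.1 ha i) _ (Fintype.mem_piFinset.1 ha' i) _ (ht i trivial) _
        (ht' i trivial) (congrFun h i)

variable {E : Type*} [NormedAddCommGroup E] [NormedSpace 𝕜 E]

theorem measurableSet_cell [MeasurableSpace E] [BorelSpace E] {D : Set E} (hD : MeasurableSet D)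
    (x : E) {u : 𝕜} (hu : u ≠ 0) : MeasurableSet (cell D x u) := by
  let e : E ≃ₜ E := (Homeomorph.smulOfNeZero u hu).trans (Homeomorph.addLeft x)
  have : cell D x u = e.toMeasurableEquiv '' D := rfl
  rw [this, MeasurableEquiv.measurableSet_image]
  exact hD

theorem measure_cell_eq [MeasurableSpace E] [BorelSpace E] {μ : Measure E} [μ.IsAddLeftInvariant]
    (D : Set E) (x y : E) (u : 𝕜) : μ (cell D x u) = μ (cell D y u) := by
  have : cell D x u = (fun z => (y - x) + z) ⁻¹' cell D y u := by
    ext z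
    simp only [cell, Set.mem_image, Set.mem_preimage]
    refine exists_congr fun t => and_congr_right fun _ => ⟨?_, fun h => ?_⟩
    · rintro rfl; abel
    · rw [show z = -(y - x) + (y - x + z) by abel, ← h]; abel
  rw [this, measure_preimage_add]

/-- Subdivision of a cell according to a partition of `D`. -/
theorem cell_eq_iUnion {D : Set E} {s : 𝕜} {A : Finset E}
    (h1 : ∀ a ∈ A, ∀ t ∈ D, a + s • t ∈ D) (h2 : ∀ t ∈ D, ∃ a ∈ A, ∃ t' ∈ D, a + s • t' = t)
    (x : E) (u : 𝕜) : cell D x u = ⋃ a ∈ A, cell D (x + u • a) (u * s) := by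
  ext y
  simp only [cell, Set.mem_image, Set.mem_iUnion]
  constructor
  · rintro ⟨t, ht, rfl⟩
    obtain ⟨a, ha, t', ht', rfl⟩ := h2 t ht
    exact ⟨a, ha, t', ht', by simp [smul_add, mul_smul, add_assoc]⟩
  · rintro ⟨a, ha, t, ht, rfl⟩
    exact ⟨_, h1 a ha t ht, by simp [smul_add, mul_smul, add_assoc]⟩

/-- The subcells are disjoint translates of one another, so translation invariance alone determines
their measure, without a formula for the measure of a dilate. -/
theorem card_mul_measure_cell [MeasurableSpace E] [BorelSpace E] {μ : Measure E}
    [μ.IsAddLeftInvariant] {D : Set E} (hD : MeasurableSet D) {s : 𝕜} (hs : s ≠ 0) {A : Finset E}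
    (h1 : ∀ a ∈ A, ∀ t ∈ D, a + s • t ∈ D) (h2 : ∀ t ∈ D, ∃ a ∈ A, ∃ t' ∈ D, a + s • t' = t)
    (h3 : ∀ a ∈ A, ∀ a' ∈ A, ∀ t ∈ D, ∀ t' ∈ D, a + s • t = a' + s • t' → a = a')
    (x y : E) {u : 𝕜} (hu : u ≠ 0) :
    A.card * μ (cell D y (u * s)) = μ (cell D x u) := by
  rw [cell_eq_iUnion h1 h2 x u, measure_biUnion_finset]
  · rw [Finset.sum_congr rfl fun a _ => measure_cell_eq D (x + u • a) y (u * s)]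
    simp
  · intro a ha a' ha' hne
    refine Set.disjoint_left.2 ?_
    rintro _ ⟨t, ht, rfl⟩ ⟨t', ht', h⟩
    refine hne (h3 a ha a' ha' t ht t' ht' ?_)
    have : u • (a' + s • t') = u • (a + s • t) := by
      simpa [smul_add, mul_smul, add_assoc] using h
    exact (smul_right_injective E hu this).symm
  · exact fun a _ => measurableSet_cell hD _ (mul_ne_zero hu hs)

end SelfSimilar

/-! ### Comparison with polynomials on small cells. -/

section Cells

variable {𝕜 : Type*} [NontriviallyNormedField 𝕜] {d m : ℕ}

/-- The coefficients of the polynomial `t ↦ P (u t)`. -/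
theorem polyEval_smul {l : ℕ} (u : 𝕜) (t : Fin d → 𝕜) (b : multiIndices d l → 𝕜) :
    polyEval d l (u • t) b = polyEval d l t fun β => b β * u ^ ∑ i, β.1 i := by
  simp only [polyEval_apply, Pi.smul_apply, smul_eq_mul, mul_pow, Finset.prod_mul_distrib,
    Finset.prod_pow_eq_pow_sum, mul_assoc]

/-- Rescaling shrinks a coefficient of degree at most `l` by no more than `‖u‖ ^ l`. A remainder of
order `‖u‖ ^ (l + 1)` is therefore smaller by a factor `‖u‖`. -/
theorem norm_mul_pow_le_norm_coeff {l : ℕ} {u : 𝕜} (hu : ‖u‖ ≤ 1) (b : multiIndices d l → 𝕜) :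
    ‖b‖ * ‖u‖ ^ l ≤ ‖fun β : multiIndices d l => b β * u ^ ∑ i, β.1 i‖ := by
  rcases eq_or_ne u 0 with rfl | hu0
  · rcases Nat.eq_zero_or_pos l with rfl | hl
    · rw [pow_zero, mul_one]
      refine (pi_norm_le_iff_of_nonneg (norm_nonneg _)).2 fun β => ?_
      have h0 : ∑ i, β.1 i = 0 := Nat.le_zero.1 (mem_multiIndices.1 β.2)
      refine le_trans (le_of_eq ?_)
        (norm_le_pi_norm (fun β : multiIndices d 0 => b β * (0 : 𝕜) ^ ∑ i, β.1 i) β)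
      simp only [h0, pow_zero, mul_one]
    · rw [norm_zero, zero_pow hl.ne', mul_zero]; positivity
  · have hu' : 0 < ‖u‖ := norm_pos_iff.2 hu0
    rw [← le_div_iff₀ (by positivity)]
    refine (pi_norm_le_iff_of_nonneg (by positivity)).2 fun β => ?_
    rw [le_div_iff₀ (by positivity)]
    refine le_trans ?_
      (norm_le_pi_norm (fun β : multiIndices d l => b β * u ^ ∑ i, β.1 i) β)
    rw [norm_mul, norm_pow]
    gcongr ?_ * ?_
    exact pow_le_pow_of_le_one hu'.le hu (mem_multiIndices.1 β.2)

/-- On small cells, linear combinations of analytic functions are comparable with polynomials: up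
to constants they reach their maximal size on every subcell, and on one of the subcells they have
this size everywhere. -/
theorem AnalyticAt.exists_comparable_on_cells [CompleteSpace 𝕜] [ProperSpace 𝕜]
    [MeasurableSpace (Fin d → 𝕜)]
    {G : (Fin d → 𝕜) → Fin m → 𝕜} {x₀ : Fin d → 𝕜} (hG : AnalyticAt 𝕜 G x₀)
    {D : Set (Fin d → 𝕜)} (hD : IsSelfSimilar 𝕜 D) :
    ∃ s : 𝕜, s ≠ 0 ∧ ‖s‖ ≤ 1 ∧ ∃ A : Finset (Fin d → 𝕜),
      (∀ a ∈ A, ∀ t ∈ D, a + s • t ∈ D) ∧ (∀ t ∈ D, ∃ a ∈ A, ∃ t' ∈ D, a + s • t' = t) ∧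
      (∀ a ∈ A, ∀ a' ∈ A, ∀ t ∈ D, ∀ t' ∈ D, a + s • t = a' + s • t' → a = a') ∧
      ∃ ρ C₁ c₁ : ℝ, 0 < ρ ∧ 0 < C₁ ∧ 0 < c₁ ∧
      ∀ c : Fin m → 𝕜, ∀ x ∈ Metric.ball x₀ ρ, ∀ u : 𝕜, ‖u‖ < ρ → ∃ N : ℝ, 0 ≤ N ∧
        (∀ y ∈ cell D x u, ‖∑ j, c j * G y j‖ ≤ C₁ * N) ∧
        (∀ a ∈ A, ∃ y ∈ cell D (x + u • a) (u * s), c₁ * N ≤ ‖∑ j, c j * G y j‖) ∧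
        ∃ a ∈ A, ∀ y ∈ cell D (x + u • a) (u * s), c₁ * N ≤ ‖∑ j, c j * G y j‖ := by
  obtain ⟨l, ρ₀, hρ₀, K, hK, hdom⟩ := hG.exists_dominating_taylor
  obtain ⟨R, hR, hDR⟩ : ∃ R : ℝ, 0 < R ∧ D ⊆ Metric.closedBall 0 R := by
    obtain ⟨R, hR⟩ := hD.isBounded.subset_closedBall 0
    exact ⟨max R 1, by positivity, hR.trans (Metric.closedBall_subset_closedBall (le_max_left _ _))⟩
  obtain ⟨C₀, hC₀, hC₀'⟩ := exists_norm_polyEval_le (𝕜 := 𝕜) d l R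
  obtain ⟨cD, hcD, hcD'⟩ := exists_norm_coeff_le (𝕜 := 𝕜) (l := l) hD.interior_nonempty
  -- Subcells will have diameter below `δ`, so that a polynomial oscillates on each by at most half
  -- of the value `cD ‖b‖` it attains somewhere in `D`.
  obtain ⟨δ, hδ, hequi⟩ := exists_norm_polyEval_sub_le (𝕜 := 𝕜) d l R (half_pos hcD)
  obtain ⟨s, hs0, hs, A, h1, h2, h3⟩ :=
    hD.exists_partition (min 1 (δ / (2 * R))) (by positivity)
  have hs1 : ‖s‖ < 1 := hs.trans_le (min_le_left _ _)
  have hs2 : ‖s‖ * (2 * R) < δ := by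
    rw [← lt_div_iff₀ (by positivity)]; exact hs.trans_le (min_le_right _ _)
  have hcA : ∀ a : Fin d → 𝕜, ∃ c : ℝ, 0 < c ∧ ∀ b : multiIndices d l → 𝕜,
      ∃ t ∈ D, c * ‖b‖ ≤ ‖polyEval d l (a + s • t) b‖ := by
    intro a
    let e : (Fin d → 𝕜) ≃ₜ (Fin d → 𝕜) :=
      (Homeomorph.smulOfNeZero s hs0).trans (Homeomorph.addLeft a)
    have hint : (interior (e '' D)).Nonempty := by
      rw [← e.image_interior]
      exact hD.interior_nonempty.image _
    obtain ⟨c, hc, hc'⟩ := exists_norm_coeff_le (𝕜 := 𝕜) (l := l) hint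
    refine ⟨c, hc, fun b => ?_⟩
    obtain ⟨_, ⟨t, ht, rfl⟩, h⟩ := hc' b
    exact ⟨t, ht, h⟩
  choose cA hcA0 hcA using hcA
  obtain ⟨a₁, ha₁, -⟩ := h2 0 hD.zero_mem
  obtain ⟨a₂, -, hmin⟩ := A.exists_min_image cA ⟨a₁, ha₁⟩
  set c₂ : ℝ := min (cD / 2) (cA a₂) with hc₂
  have hc₂0 : 0 < c₂ := lt_min (by positivity) (hcA0 _)
  have hKR : 0 < K * R ^ (l + 1) + 1 := by positivity
  -- The bounds on `‖u‖` keep the cell within reach of the Taylor estimate and make the rescaled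
  -- remainder at most `c₂ / 2` times the coefficient norm, half the polynomial lower bound.
  refine ⟨s, hs0, hs1.le, A, h1, h2, h3,
    min (min ρ₀ 1) (min (ρ₀ / R) (c₂ / 2 / (K * R ^ (l + 1) + 1))), C₀ + c₂ / 2, c₂ / 2,
    by positivity, by positivity, by positivity, fun c x hx u hu => ?_⟩
  have hu1 : ‖u‖ ≤ 1 := (hu.trans_le ((min_le_left _ _).trans (min_le_right _ _))).le
  have hu2 : ‖u‖ * R < ρ₀ := by
    rw [← lt_div_iff₀ hR]
    exact hu.trans_le ((min_le_right _ _).trans (min_le_left _ _))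
  have hu3 : (K * R ^ (l + 1) + 1) * ‖u‖ ≤ c₂ / 2 := by
    rw [mul_comm, ← le_div_iff₀ hKR]
    exact (hu.trans_le ((min_le_right _ _).trans (min_le_right _ _))).le
  obtain ⟨b, hb⟩ := hdom c x
    (Metric.ball_subset_ball ((min_le_left _ _).trans (min_le_left _ _)) hx)
  set b' : multiIndices d l → 𝕜 := fun β => b β * u ^ ∑ i, β.1 i with hb'
  have hbb' : ‖b‖ * ‖u‖ ^ l ≤ ‖b'‖ := norm_mul_pow_le_norm_coeff hu1 b
  have key : ∀ t ∈ D, ‖∑ j, c j * G (x + u • t) j - polyEval d l t b'‖ ≤ c₂ / 2 * ‖b'‖ := by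
    intro t ht
    have htR : ‖t‖ ≤ R := by simpa using hDR ht
    have hut : ‖u • t‖ ≤ ‖u‖ * R := by rw [norm_smul]; gcongr
    rw [← polyEval_smul]
    refine (hb (u • t) (hut.trans_lt hu2)).trans ?_
    calc K * ‖b‖ * ‖u • t‖ ^ (l + 1) ≤ K * ‖b‖ * (‖u‖ * R) ^ (l + 1) := by gcongr
      _ = K * R ^ (l + 1) * ‖u‖ * (‖b‖ * ‖u‖ ^ l) := by ring
      _ ≤ K * R ^ (l + 1) * ‖u‖ * ‖b'‖ := by gcongr
      _ ≤ (K * R ^ (l + 1) + 1) * ‖u‖ * ‖b'‖ := by gcongr; linarith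
      _ ≤ _ := by gcongr
  have lower : ∀ t ∈ D, c₂ * ‖b'‖ ≤ ‖polyEval d l t b'‖ →
      c₂ / 2 * ‖b'‖ ≤ ‖∑ j, c j * G (x + u • t) j‖ := by
    intro t ht h
    have := norm_sub_norm_le (polyEval d l t b') (∑ j, c j * G (x + u • t) j)
    have h' := key t ht
    rw [norm_sub_rev] at h'
    linarith
  have hsubcell : ∀ a t, x + u • a + (u * s) • t = x + u • (a + s • t) := fun a t => by
    simp [smul_add, mul_smul, add_assoc]
  refine ⟨‖b'‖, norm_nonneg _, ?_, ?_, ?_⟩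
  · rintro _ ⟨t, ht, rfl⟩
    have := norm_sub_norm_le (∑ j, c j * G (x + u • t) j) (polyEval d l t b')
    have h' := key t ht
    have h'' := hC₀' t (hDR ht) b'
    rw [add_mul]
    linarith
  · intro a ha
    obtain ⟨t, ht, h⟩ := hcA a b'
    refine ⟨_, ⟨t, ht, rfl⟩, ?_⟩
    simp only [hsubcell]
    refine lower _ (h1 a ha t ht) (le_trans ?_ h)
    gcongr
    exact (min_le_right _ _).trans (hmin a ha)
  -- The good subcell is the one containing a point where the polynomial is at least `cD ‖b'‖`.
  · obtain ⟨t₀, ht₀, h₀⟩ := hcD' b'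
    obtain ⟨a, ha, t₁, ht₁, rfl⟩ := h2 t₀ ht₀
    refine ⟨a, ha, ?_⟩
    rintro _ ⟨t, ht, rfl⟩
    simp only [hsubcell]
    refine lower _ (h1 a ha t ht) ?_
    have hdist : dist (a + s • t₁) (a + s • t) < δ := by
      rw [dist_add_left, dist_smul₀]
      refine lt_of_le_of_lt ?_ hs2
      gcongr
      have e1 : dist t₁ 0 ≤ R := hDR ht₁
      have e2 : dist t 0 ≤ R := hDR ht
      linarith [dist_triangle_right t₁ t 0]
    have h4 := hequi _ (hDR (h1 a ha t₁ ht₁)) _ (hDR (h1 a ha t ht)) hdist b'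
    have h5 := norm_sub_norm_le (polyEval d l (a + s • t₁) b') (polyEval d l (a + s • t) b')
    have h6 : c₂ * ‖b'‖ ≤ cD / 2 * ‖b'‖ := by
      gcongr
      exact min_le_left _ _
    linarith

end Cells

/-! ### Goodness on cells and on sets comparable with balls. -/

section Good

open MeasureTheory

variable {𝕜 : Type*} [NontriviallyNormedField 𝕜] {d m : ℕ}

/-- Linear combinations of analytic functions are uniformly good on small cells. -/
theorem AnalyticAt.exists_good_on_cells [CompleteSpace 𝕜] [ProperSpace 𝕜]
    [MeasurableSpace 𝕜] [BorelSpace 𝕜] {μ : Measure (Fin d → 𝕜)} [μ.IsAddLeftInvariant]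
    {G : (Fin d → 𝕜) → Fin m → 𝕜} {x₀ : Fin d → 𝕜} (hG : AnalyticAt 𝕜 G x₀)
    {D : Set (Fin d → 𝕜)} (hD : IsSelfSimilar 𝕜 D) :
    ∃ ρ C α : ℝ, 0 < ρ ∧ 1 ≤ C ∧ 0 < α ∧ ∀ c : Fin m → 𝕜, ∀ x, ∀ u : 𝕜, u ≠ 0 → ‖u‖ < ρ →
      cell D x u ⊆ Metric.ball x₀ ρ → ∀ ε : ℝ, 0 < ε →
      μ {y ∈ cell D x u | ‖∑ j, c j * G y j‖ₑ < ENNReal.ofReal ε} ≤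
        ENNReal.ofReal C * (ENNReal.ofReal ε / ⨆ y ∈ cell D x u, ‖∑ j, c j * G y j‖ₑ) ^ α *
          μ (cell D x u) := by
  obtain ⟨s, hs0, hs1, A, h1, h2, h3, ρ, C₁, c₁, hρ, hC₁, hc₁, H⟩ := hG.exists_comparable_on_cells hD
  -- The guaranteed proportion of the supremum is `c₁ / C₁`; the cap `1/2` keeps `log κ` negative.
  set κ : ℝ := min (c₁ / C₁) (1 / 2) with hκ
  have hκ0 : 0 < κ := by positivity
  have hκ1 : κ < 1 := (min_le_right _ _).trans_lt (by norm_num)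
  have hκc : κ * C₁ ≤ c₁ := by
    rw [← le_div_iff₀ hC₁]; exact min_le_left _ _
  obtain ⟨a₁, ha₁, -⟩ := h2 0 hD.zero_mem
  have hA : 0 < A.card := Finset.card_pos.2 ⟨a₁, ha₁⟩
  set n : ℝ := (A.card : ℝ) with hn
  have hn0 : 0 < n := by rw [hn]; exact_mod_cast hA
  -- Counting pieces would give `(n - 1) / n`; the larger `n / (n + 1)` is also positive when `n =
  -- 1`.
  set θ : ℝ := n / (n + 1) with hθ
  have hθ0 : 0 < θ := by positivity
  have hθ1 : θ < 1 := by rw [hθ, div_lt_one (by positivity)]; linarith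
  refine ⟨ρ, θ⁻¹, Real.log θ / Real.log κ, hρ, (one_le_inv₀ hθ0).2 hθ1.le,
    div_pos_of_neg_of_neg (Real.log_neg hθ0 hθ1) (Real.log_neg hκ0 hκ1), fun c x u hu0 huρ hsub ε hε => ?_⟩
  set h : (Fin d → 𝕜) → ℝ≥0∞ := fun y => ‖∑ j, c j * G y j‖ₑ with hh
  -- This family is closed under subdivision, and since `0 ∈ D` the base point of each member lies
  -- in the ball where the comparison applies.
  let 𝒬 : Set (Set (Fin d → 𝕜)) :=
    {Q | ∃ x, ∃ u : 𝕜, u ≠ 0 ∧ ‖u‖ < ρ ∧ Q ⊆ Metric.ball x₀ ρ ∧ Q = cell D x u}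
  have hcentre : ∀ x (u : 𝕜), x ∈ cell D x u := fun x u => ⟨0, hD.zero_mem, by simp⟩
  have hupper : ∀ x (u : 𝕜) (N : ℝ), (∀ y ∈ cell D x u, ‖∑ j, c j * G y j‖ ≤ C₁ * N) →
      ⨆ y ∈ cell D x u, h y ≤ ENNReal.ofReal (C₁ * N) := by
    intro x u N hN
    refine iSup₂_le fun y hy => ?_
    rw [hh]
    simp only
    rw [← ofReal_norm]
    exact ENNReal.ofReal_le_ofReal (hN y hy)
  have hstep : ∀ Q ∈ 𝒬, ∃ q : A → Set (Fin d → 𝕜), (∀ i, q i ∈ 𝒬) ∧ Q ⊆ ⋃ i, q i ∧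
      (∀ i, Fintype.card A * μ (q i) = μ Q) ∧
      (∀ i, ENNReal.ofReal κ * ⨆ y ∈ Q, h y ≤ ⨆ y ∈ q i, h y) ∧
      ∃ i, ∀ y ∈ q i, ENNReal.ofReal κ * ⨆ y ∈ Q, h y ≤ h y := by
    rintro _ ⟨x, u, hu0, huρ, hsub, rfl⟩
    have hcov := cell_eq_iUnion h1 h2 x u
    obtain ⟨N, hN, hup, hlow, a₀, ha₀, hbig⟩ := H c x (hsub (hcentre x u)) u huρ
    have hκS : ENNReal.ofReal κ * ⨆ y ∈ cell D x u, h y ≤ ENNReal.ofReal (c₁ * N) := by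
      calc _ ≤ ENNReal.ofReal κ * ENNReal.ofReal (C₁ * N) := by gcongr; exact hupper x u N hup
        _ = ENNReal.ofReal (κ * C₁ * N) := by rw [← ENNReal.ofReal_mul hκ0.le, mul_assoc]
        _ ≤ _ := by gcongr
    have hle : ∀ y, c₁ * N ≤ ‖∑ j, c j * G y j‖ → ENNReal.ofReal (c₁ * N) ≤ h y := by
      intro y hy
      rw [hh]
      simp only
      rw [← ofReal_norm]
      exact ENNReal.ofReal_le_ofReal hy
    refine ⟨fun a => cell D (x + u • a.1) (u * s), fun a => ?_, ?_, fun a => ?_, fun a => ?_, ?_⟩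
    · refine ⟨_, _, mul_ne_zero hu0 hs0, ?_, ?_, rfl⟩
      · rw [norm_mul]
        exact (mul_le_of_le_one_right (norm_nonneg _) hs1).trans_lt huρ
      · refine Set.Subset.trans ?_ hsub
        rw [hcov]
        exact Set.subset_biUnion_of_mem (u := fun a => cell D (x + u • a) (u * s)) a.2
    · rw [hcov]
      simp only [Set.iUnion_subtype, subset_refl]
    · rw [Fintype.card_coe]
      exact card_mul_measure_cell hD.measurableSet hs0 h1 h2 h3 x _ hu0
    · obtain ⟨y, hy, hyN⟩ := hlow a.1 a.2
      exact (hκS.trans (hle y hyN)).trans (le_iSup₂ (f := fun y _ => h y) y hy)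
    · exact ⟨⟨a₀, ha₀⟩, fun y hy => hκS.trans (hle y (hbig y hy))⟩
  have hθn : (Fintype.card A : ℝ≥0∞) ≤ ENNReal.ofReal θ * (Fintype.card A + 1) := by
    have e : (A.card : ℝ≥0∞) = ENNReal.ofReal n := (ENNReal.ofReal_natCast _).symm
    rw [Fintype.card_coe, e, ← ENNReal.ofReal_one, ← ENNReal.ofReal_add hn0.le zero_le_one,
      ← ENNReal.ofReal_mul hθ0.le, hθ, div_mul_cancel₀ _ (by positivity)]
  have hdecay := fun k => measure_sublevel_le_of_subdivision (μ := μ)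
    (ENNReal.ofReal_le_one.2 hκ1.le) hθn (ENNReal.ofReal_le_one.2 hθ1.le) hstep k (cell D x u)
    ⟨x, u, hu0, huρ, hsub, rfl⟩
  obtain ⟨N, -, hup, -⟩ := H c x (hsub (hcentre x u)) u huρ
  exact power_bound_of_geometric_decay
    (F := fun z => μ {y ∈ cell D x u | h y < z})
    (fun z z' hz => measure_mono fun y hy => ⟨hy.1, hy.2.trans_le hz⟩)
    (fun z => measure_mono (Set.sep_subset _ _)) hκ0 hκ1 hθ0 hθ1
    (ne_top_of_le_ne_top ENNReal.ofReal_ne_top (hupper x u N hup)) hdecay hε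

/-- Some vector of norm in `[r / ‖g‖, r)` joins two points of the larger ball. The factor `‖g‖`
allows for gaps in the values of the norm, where a ball does not determine its radius. -/
theorem le_mul_of_ball_subset_ball {E : Type*} [NormedAddCommGroup E] [NormedSpace 𝕜 E]
    [Nontrivial E] {g : 𝕜} (hg : 1 < ‖g‖) {x x₀ : E} {r ρ : ℝ} (hr : 0 < r)
    (h : Metric.ball x r ⊆ Metric.ball x₀ ρ) : r ≤ 2 * ‖g‖ * ρ := by
  obtain ⟨e, he⟩ := exists_ne (0 : E)
  obtain ⟨v, -, hv1, hv2, -⟩ := rescale_to_shell hg hr he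
  have hx := h (Metric.mem_ball_self hr)
  have hxv := h (show x + v • e ∈ Metric.ball x r by simpa [mem_ball_iff_norm] using hv1)
  rw [mem_ball_iff_norm] at hx hxv
  have hlt : ‖v • e‖ < 2 * ρ := by
    calc ‖v • e‖ = ‖(x + v • e - x₀) - (x - x₀)‖ := by congr 1; abel
      _ ≤ _ := norm_sub_le _ _
      _ < _ := by linarith
  have := hv2.trans hlt.le
  rw [div_le_iff₀ (by linarith)] at this
  linarith

/-- Linear combinations of analytic functions are uniformly good on all small sets which are
comparable with balls, with every sufficiently small exponent. -/
theorem AnalyticAt.exists_good_on_sets [CompleteSpace 𝕜] [ProperSpace 𝕜]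
    [MeasurableSpace 𝕜] [BorelSpace 𝕜] (hd : 0 < d) {μ : Measure (Fin d → 𝕜)}
    [μ.IsAddLeftInvariant] {G : (Fin d → 𝕜) → Fin m → 𝕜} {x₀ : Fin d → 𝕜} (hG : AnalyticAt 𝕜 G x₀)
    {D : Set 𝕜} (hD₁ : IsSelfSimilar 𝕜 D) {Λ : ℝ} (hΛ : 1 ≤ Λ) :
    ∃ ρ C α : ℝ, 0 < ρ ∧ 1 ≤ C ∧ 0 < α ∧ ∀ α', 0 < α' → α' ≤ α → ∀ c : Fin m → 𝕜,
      ∀ (S : Set (Fin d → 𝕜)) (x : Fin d → 𝕜) (r : ℝ), 0 < r → Metric.ball x r ⊆ S →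
      S ⊆ Metric.ball x (Λ * r) → S ⊆ Metric.ball x₀ ρ → ∀ ε : ℝ, 0 < ε →
      μ {y ∈ S | ‖∑ j, c j * G y j‖ₑ < ENNReal.ofReal ε} ≤
        ENNReal.ofReal C * (ENNReal.ofReal ε / ⨆ y ∈ S, ‖∑ j, c j * G y j‖ₑ) ^ α' * μ S := by
  have : Nonempty (Fin d) := ⟨⟨0, hd⟩⟩
  have hD := hD₁.pi d
  set D' : Set (Fin d → 𝕜) := Set.pi Set.univ fun _ => D
  obtain ⟨ρ, C, α, hρ, hC, hα, H⟩ := hG.exists_good_on_cells (μ := μ) hD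
  obtain ⟨g, hg⟩ := NormedField.exists_one_lt_norm 𝕜
  obtain ⟨R, hR, hDR⟩ : ∃ R : ℝ, 0 < R ∧ D' ⊆ Metric.closedBall 0 R := by
    obtain ⟨R, hR⟩ := hD.isBounded.subset_closedBall 0
    exact ⟨max R 1, by positivity, hR.trans (Metric.closedBall_subset_closedBall (le_max_left _ _))⟩
  obtain ⟨a₀, ha₀⟩ := hD.interior_nonempty
  obtain ⟨τ, hτ, hτD⟩ := Metric.mem_nhds_iff.1 (mem_interior_iff_mem_nhds.1 ha₀)
  have hg0 : 0 < ‖g‖ := by linarith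
  have hΛ0 : 0 < Λ := by linarith
  -- This second subdivision only compares measures: one subcell of the cell enclosing `S` will fit
  -- into the ball inside `S`, giving `μ Q ≤ A.card * μ S`.
  obtain ⟨s, hs0, hs, A, h1, h2, h3⟩ :=
    hD.exists_partition (τ / (‖g‖ * Λ * R)) (by positivity)
  have hA : 1 ≤ A.card := by
    obtain ⟨a₁, ha₁, -⟩ := h2 0 hD.zero_mem
    exact Finset.card_pos.2 ⟨a₁, ha₁⟩
  have hA' : (1 : ℝ) ≤ A.card := by exact_mod_cast hA
  set B : ℝ := 2 * ‖g‖ ^ 2 * Λ / τ with hB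
  have hB0 : 0 < B := by positivity
  -- The enclosing cell has scale below `B` times the new radius. The first term keeps this scale
  -- below `ρ`, the second keeps the cell in the ball of radius `ρ`.
  refine ⟨min (ρ / B) (ρ / (1 + B * (2 * R))), C * A.card, α, by positivity,
    one_le_mul_of_one_le_of_one_le hC hA', hα, fun α' hα' hαα c S x r hr hrS hSr hSρ ε hε => ?_⟩
  set h : (Fin d → 𝕜) → ℝ≥0∞ := fun y => ‖∑ j, c j * G y j‖ₑ with hh
  -- If the ratio is at least `1` the claim is trivial; otherwise lowering the exponent only raises
  -- the power. Hence one constant serves all `α' ≤ α`.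
  by_cases hz : 1 ≤ ENNReal.ofReal ε / ⨆ y ∈ S, h y
  · calc μ {y ∈ S | h y < ENNReal.ofReal ε} ≤ 1 * 1 * μ S := by
          simpa using measure_mono (Set.sep_subset _ _)
      _ ≤ _ := by
          gcongr
          · exact ENNReal.one_le_ofReal.2 (one_le_mul_of_one_le_of_one_le hC hA')
          · exact ENNReal.one_le_rpow hz hα'
  push Not at hz
  set ρ' : ℝ := min (ρ / B) (ρ / (1 + B * (2 * R))) with hρ'
  have hrρ : r ≤ 2 * ‖g‖ * ρ' := le_mul_of_ball_subset_ball hg hr (hrS.trans hSρ)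
  -- The lower bound `Λ r / τ ≤ ‖u‖` makes the cell with `a₀` placed at `x` cover the ball of radius
  -- `Λ r`; the upper bound keeps it comparable with `r`.
  obtain ⟨u, hu0, hu1, hu2, -⟩ := rescale_to_shell (𝕜 := 𝕜) hg
    (show 0 < ‖g‖ * Λ * r / τ by positivity) (one_ne_zero (α := 𝕜))
  rw [smul_eq_mul, mul_one] at hu1 hu2
  have hu2' : Λ * r / τ ≤ ‖u‖ := by
    refine le_trans (le_of_eq ?_) hu2
    field_simp
  have hun : 0 < ‖u‖ := norm_pos_iff.2 hu0
  have huB : ‖u‖ < B * ρ' := by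
    refine hu1.trans_le ?_
    calc ‖g‖ * Λ * r / τ ≤ ‖g‖ * Λ * (2 * ‖g‖ * ρ') / τ := by gcongr
      _ = _ := by rw [hB]; ring
  have huρ : ‖u‖ < ρ := by
    refine huB.trans_le ?_
    rw [mul_comm, ← le_div_iff₀ hB0]
    exact min_le_left _ _
  set Q := cell D' (x - u • a₀) u with hQ
  have hSQ : S ⊆ Q := by
    intro y hy
    have hy' := hSr hy
    rw [mem_ball_iff_norm] at hy'
    refine ⟨a₀ + u⁻¹ • (y - x), hτD ?_, ?_⟩
    · rw [mem_ball_iff_norm, add_sub_cancel_left, norm_smul, norm_inv, inv_mul_lt_iff₀ hun]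
      refine hy'.trans_le ?_
      rwa [div_le_iff₀ hτ] at hu2'
    · simp only [smul_add, smul_inv_smul₀ hu0]
      abel
  have hQρ : Q ⊆ Metric.ball x₀ ρ := by
    rintro _ ⟨t, ht, rfl⟩
    have hx := hSρ (hrS (Metric.mem_ball_self hr))
    rw [mem_ball_iff_norm] at hx ⊢
    have ht' : ‖t‖ ≤ R := by simpa using hDR ht
    have ha' : ‖a₀‖ ≤ R := by simpa using hDR (interior_subset ha₀)
    calc ‖x - u • a₀ + u • t - x₀‖ = ‖(x - x₀) + u • (t - a₀)‖ := by
          congr 1; rw [smul_sub]; abel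
      _ ≤ ‖x - x₀‖ + ‖u‖ * ‖t - a₀‖ := by
          rw [← norm_smul]; exact norm_add_le _ _
      _ ≤ ‖x - x₀‖ + (B * ρ') * (2 * R) := by
          gcongr
          linarith [norm_sub_le t a₀]
      _ < ρ' + (B * ρ') * (2 * R) := by gcongr
      _ = ρ' * (1 + B * (2 * R)) := by ring
      _ ≤ ρ := by
          rw [← le_div_iff₀ (by positivity)]
          exact min_le_right _ _
  have hμ : μ Q ≤ A.card * μ S := by
    rw [hQ, ← card_mul_measure_cell hD.measurableSet hs0 h1 h2 h3 _ x hu0]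
    gcongr
    refine Set.Subset.trans ?_ hrS
    rintro _ ⟨t, ht, rfl⟩
    have ht' : ‖t‖ ≤ R := by simpa using hDR ht
    rw [mem_ball_iff_norm, add_sub_cancel_left, norm_smul, norm_mul]
    rw [lt_div_iff₀ (by positivity)] at hs
    calc ‖u‖ * ‖s‖ * ‖t‖ ≤ ‖u‖ * ‖s‖ * R := by gcongr
      _ ≤ (‖g‖ * Λ * r / τ) * ‖s‖ * R := by gcongr
      _ = ‖s‖ * (‖g‖ * Λ * R) * r / τ := by ring
      _ < τ * r / τ := by gcongr
      _ = r := by field_simp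
  have hsup : ⨆ y ∈ S, h y ≤ ⨆ y ∈ Q, h y := biSup_mono fun y hy => hSQ hy
  calc μ {y ∈ S | h y < ENNReal.ofReal ε} ≤ μ {y ∈ Q | h y < ENNReal.ofReal ε} :=
        measure_mono fun y hy => ⟨hSQ hy.1, hy.2⟩
    _ ≤ ENNReal.ofReal C * (ENNReal.ofReal ε / ⨆ y ∈ Q, h y) ^ α * μ Q :=
        H c _ u hu0 huρ hQρ ε hε
    _ ≤ ENNReal.ofReal C * (ENNReal.ofReal ε / ⨆ y ∈ S, h y) ^ α' * (A.card * μ S) := by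
        gcongr ENNReal.ofReal C * ?_ * ?_
        calc _ ≤ (ENNReal.ofReal ε / ⨆ y ∈ S, h y) ^ α := by gcongr
          _ ≤ _ := ENNReal.rpow_le_rpow_of_exponent_ge hz.le hαα
    _ = _ := by
        rw [ENNReal.ofReal_mul (by positivity), ENNReal.ofReal_natCast]
        ring

end Good

/-! ### Transfer to balls of other norms and to maxima of several combinations. -/

section NormedSpaces

open MeasureTheory

variable {𝕜 : Type*} [NontriviallyNormedField 𝕜] [CompleteSpace 𝕜] [ProperSpace 𝕜]
  [MeasurableSpace 𝕜] [BorelSpace 𝕜] {d m : ℕ} {X : Type*} [NormedAddCommGroup X]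
  [NormedSpace 𝕜 X] [MeasurableSpace X] [BorelSpace X]

/-- Linear combinations of analytic functions on a `d`-dimensional space are uniformly good near
any point. -/
theorem exists_good_on_balls (hd : 0 < d) (e : X ≃L[𝕜] (Fin d → 𝕜)) {μ : Measure X}
    [μ.IsAddHaarMeasure] {g : Fin m → X → 𝕜} {x₀ : X} (hg : ∀ j, AnalyticAt 𝕜 (g j) x₀)
    {D : Set 𝕜} (hD : IsSelfSimilar 𝕜 D) :
    ∃ ρ C α : ℝ, 0 < ρ ∧ 1 ≤ C ∧ 0 < α ∧ ∀ α', 0 < α' → α' ≤ α → ∀ c : Fin m → 𝕜,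
      ∀ (x : X) (r : ℝ), 0 < r → Metric.ball x r ⊆ Metric.ball x₀ ρ → ∀ ε : ℝ, 0 < ε →
      μ {y ∈ Metric.ball x r | ‖∑ j, c j * g j y‖ₑ < ENNReal.ofReal ε} ≤
        ENNReal.ofReal C *
          (ENNReal.ofReal ε / ⨆ y ∈ Metric.ball x r, ‖∑ j, c j * g j y‖ₑ) ^ α' *
            μ (Metric.ball x r) := by
  obtain ⟨K₁, hK₁, hK₁'⟩ : ∃ K : ℝ, 1 ≤ K ∧ ∀ v, ‖e v‖ ≤ K * ‖v‖ := by
    obtain ⟨K, -, hK⟩ := (e : X →L[𝕜] (Fin d → 𝕜)).bound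
    exact ⟨max K 1, le_max_right _ _, fun v => (hK v).trans (by gcongr; exact le_max_left _ _)⟩
  obtain ⟨K₂, hK₂, hK₂'⟩ : ∃ K : ℝ, 1 ≤ K ∧ ∀ v, ‖e.symm v‖ ≤ K * ‖v‖ := by
    obtain ⟨K, -, hK⟩ := (e.symm : (Fin d → 𝕜) →L[𝕜] X).bound
    exact ⟨max K 1, le_max_right _ _, fun v => (hK v).trans (by gcongr; exact le_max_left _ _)⟩
  have hG : AnalyticAt 𝕜 (fun y j => g j (e.symm y)) (e x₀) := by
    refine AnalyticAt.pi fun j => ?_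
    refine AnalyticAt.comp (g := g j) (by simpa using hg j) ?_
    exact (e.symm : (Fin d → 𝕜) →L[𝕜] X).analyticAt _
  -- The image of a ball under `e` lies between balls of the maximum norm with radii in ratio `K₁ *
  -- K₂`.
  obtain ⟨ρ, C, α, hρ, hC, hα, H⟩ := hG.exists_good_on_sets hd (μ := μ.map e) hD
    (one_le_mul_of_one_le_of_one_le hK₁ hK₂)
  refine ⟨ρ / K₁, C, α, by positivity, hC, hα, fun α' h0 hle c x r hr hsub ε hε => ?_⟩
  have himg : ∀ (z : X) (s : ℝ), e '' Metric.ball z s ⊆ Metric.ball (e z) (K₁ * s) := by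
    rintro z s _ ⟨y, hy, rfl⟩
    rw [mem_ball_iff_norm] at hy ⊢
    rw [← map_sub]
    exact (hK₁' _).trans_lt (by gcongr)
  have h1 : Metric.ball (e x) (r / K₂) ⊆ e '' Metric.ball x r := by
    intro y hy
    refine ⟨e.symm y, ?_, e.apply_symm_apply y⟩
    rw [mem_ball_iff_norm] at hy ⊢
    have : e.symm y - x = e.symm (y - e x) := by simp
    rw [this]
    refine (hK₂' _).trans_lt ?_
    rw [lt_div_iff₀ (by positivity)] at hy
    linarith
  have h2 : e '' Metric.ball x r ⊆ Metric.ball (e x) (K₁ * K₂ * (r / K₂)) := by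
    refine (himg x r).trans (le_of_eq ?_)
    congr 1
    field_simp
  have h3 : e '' Metric.ball x r ⊆ Metric.ball (e x₀) ρ := by
    refine (Set.image_mono hsub).trans ((himg _ _).trans (le_of_eq ?_))
    congr 1
    field_simp
  have key := H α' h0 hle c _ (e x) (r / K₂) (by positivity) h1 h2 h3 ε hε
  have hmap : ∀ T, μ.map e T = μ (e ⁻¹' T) :=
    fun T => e.toHomeomorph.toMeasurableEquiv.map_apply T
  rw [hmap, hmap, Set.preimage_image_eq _ e.injective, iSup_image] at key
  convert key using 2
  · ext y
    simp [e.injective.eq_iff]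
  · simp

/-- If `F` is comparable with the maximum of several linear combinations of analytic functions with
the same coefficients, then `F` is good, uniformly in the coefficients. -/
theorem exists_good_of_comparable {k : ℕ} (hk : 0 < k) (hd : 0 < d) (e : X ≃L[𝕜] (Fin d → 𝕜))
    {μ : Measure X} [μ.IsAddHaarMeasure] {g : Fin k → Fin m → X → 𝕜} {x₀ : X}
    (hg : ∀ i j, AnalyticAt 𝕜 (g i j) x₀) {D : Set 𝕜} (hD : IsSelfSimilar 𝕜 D) {Λ : ℝ}
    (hΛ : 1 ≤ Λ) :
    ∃ ρ C α : ℝ, 0 < ρ ∧ 1 ≤ C ∧ 0 < α ∧ ∀ α', 0 < α' → α' ≤ α → ∀ c : Fin m → 𝕜,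
      ∀ {E : Type*} [NormedAddCommGroup E] (F : X → E) (x : X) (r : ℝ), 0 < r →
      Metric.ball x r ⊆ Metric.ball x₀ ρ →
      (∀ y ∈ Metric.ball x r, ∀ i, ‖∑ j, c j * g i j y‖ ≤ ‖F y‖) →
      (∀ y ∈ Metric.ball x r, ∃ i, ‖F y‖ ≤ Λ * ‖∑ j, c j * g i j y‖) → ∀ ε : ℝ, 0 < ε →
      μ {y ∈ Metric.ball x r | ‖F y‖ < ε} ≤
        ENNReal.ofReal C * (ENNReal.ofReal ε / ⨆ y ∈ Metric.ball x r, ‖F y‖ₑ) ^ α' *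
            μ (Metric.ball x r) := by
  have : Nonempty (Fin k) := ⟨⟨0, hk⟩⟩
  choose ρ C α hρ hC hα H using fun i => exists_good_on_balls hd e (μ := μ) (hg i) hD
  obtain ⟨i₁, hi₁⟩ := Finite.exists_min ρ
  obtain ⟨i₂, hi₂⟩ := Finite.exists_max C
  obtain ⟨i₃, hi₃⟩ := Finite.exists_min α
  -- Capping the exponent at `1` gives `Λ ^ α' ≤ Λ`, so the constant does not depend on `α'`.
  refine ⟨ρ i₁, C i₂ * Λ, min (α i₃) 1, hρ _, one_le_mul_of_one_le_of_one_le (hC _) hΛ,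
    lt_min (hα _) one_pos, fun α' h0 hle c E _ F x r hr hsub hF1 hF2 ε hε => ?_⟩
  set s : Fin k → ℝ≥0∞ := fun i => ⨆ y ∈ Metric.ball x r, ‖∑ j, c j * g i j y‖ₑ with hs
  -- The combination with the largest supremum suffices: its supremum is at least that of `F` over
  -- `Λ`, and it is small wherever `F` is.
  obtain ⟨i, hi⟩ := Finite.exists_max s
  have hΛ0 : 0 < Λ := by linarith
  have hsup : ⨆ y ∈ Metric.ball x r, ‖F y‖ₑ ≤ ENNReal.ofReal Λ * s i := by
    refine iSup₂_le fun y hy => ?_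
    obtain ⟨i', hi'⟩ := hF2 y hy
    calc ‖F y‖ₑ ≤ ENNReal.ofReal Λ * ‖∑ j, c j * g i' j y‖ₑ := by
          rw [← ofReal_norm, ← ofReal_norm, ← ENNReal.ofReal_mul hΛ0.le]
          exact ENNReal.ofReal_le_ofReal hi'
      _ ≤ ENNReal.ofReal Λ * s i' := by
          gcongr
          exact le_iSup₂ (f := fun y _ => ‖∑ j, c j * g i' j y‖ₑ) y hy
      _ ≤ _ := by gcongr; exact hi i'
  have hdiv : ENNReal.ofReal ε / s i ≤
      ENNReal.ofReal Λ * (ENNReal.ofReal ε / ⨆ y ∈ Metric.ball x r, ‖F y‖ₑ) := by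
    rw [← ENNReal.mul_div_mul_left (ENNReal.ofReal ε) (s i) (c := ENNReal.ofReal Λ)
      (by simpa using hΛ0) ENNReal.ofReal_ne_top, mul_div_assoc]
    gcongr
  calc μ {y ∈ Metric.ball x r | ‖F y‖ < ε}
      ≤ μ {y ∈ Metric.ball x r | ‖∑ j, c j * g i j y‖ₑ < ENNReal.ofReal ε} := by
        refine measure_mono fun y hy => ⟨hy.1, ?_⟩
        rw [← ofReal_norm, ENNReal.ofReal_lt_ofReal_iff hε]
        exact (hF1 y hy.1 i).trans_lt hy.2
    _ ≤ ENNReal.ofReal (C i) * (ENNReal.ofReal ε / s i) ^ α' * μ (Metric.ball x r) :=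
        H i α' h0 ((hle.trans (min_le_left _ _)).trans (hi₃ i)) c x r hr
          (hsub.trans (Metric.ball_subset_ball (hi₁ i))) ε hε
    _ ≤ ENNReal.ofReal (C i₂) * (ENNReal.ofReal Λ *
          (ENNReal.ofReal ε / ⨆ y ∈ Metric.ball x r, ‖F y‖ₑ) ^ α') * μ (Metric.ball x r) := by
        gcongr ENNReal.ofReal ?_ * ?_ * _
        · exact hi₂ i
        · calc (ENNReal.ofReal ε / s i) ^ α'
              ≤ (ENNReal.ofReal Λ *
                (ENNReal.ofReal ε / ⨆ y ∈ Metric.ball x r, ‖F y‖ₑ)) ^ α' := by gcongr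
            _ = ENNReal.ofReal Λ ^ α' *
                (ENNReal.ofReal ε / ⨆ y ∈ Metric.ball x r, ‖F y‖ₑ) ^ α' :=
              ENNReal.mul_rpow_of_nonneg _ _ h0.le
            _ ≤ ENNReal.ofReal Λ ^ (1 : ℝ) *
                (ENNReal.ofReal ε / ⨆ y ∈ Metric.ball x r, ‖F y‖ₑ) ^ α' := by
              gcongr
              · exact ENNReal.one_le_ofReal.2 hΛ
              · exact hle.trans (min_le_right _ _)
            _ = _ := by rw [ENNReal.rpow_one]
    _ = _ := by
        rw [ENNReal.ofReal_mul (zero_le_one.trans (hC i₂))]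
        ring

end NormedSpaces

/-! ### The model cells over `ℝ` and `ℚ_p`. -/

section SelfSimilarSets

/-- Cut into `N` intervals of length `1 / N`; being half-open, they are exactly disjoint. -/
theorem isSelfSimilar_Ico : IsSelfSimilar ℝ (Set.Ico (0 : ℝ) 1) where
  zero_mem := by simp
  measurableSet := measurableSet_Ico
  isBounded := Metric.isBounded_Ico 0 1
  interior_nonempty := by rw [interior_Ico]; exact Set.nonempty_Ioo.2 one_pos
  exists_partition := by
    intro η hη
    obtain ⟨n, hn⟩ := exists_nat_one_div_lt hη
    set N : ℝ := (n : ℝ) + 1 with hN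
    have hN0 : 0 < N := by positivity
    rw [one_div] at hn
    refine ⟨N⁻¹, by positivity, by rwa [Real.norm_of_nonneg (by positivity)],
      (Finset.range (n + 1)).image fun k : ℕ => N⁻¹ * k, ?_, ?_, ?_⟩
    · intro a ha t ht
      obtain ⟨k, hk, rfl⟩ := Finset.mem_image.1 ha
      have hk' : (k : ℝ) + 1 ≤ N := by
        rw [hN]; exact_mod_cast Finset.mem_range.1 hk
      rw [smul_eq_mul, ← mul_add]
      refine ⟨by have := ht.1; positivity, ?_⟩
      rw [inv_mul_lt_iff₀ hN0, mul_one]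
      linarith [ht.2]
    · intro t ht
      have hfl := Nat.floor_le (mul_nonneg hN0.le ht.1)
      refine ⟨N⁻¹ * ⌊N * t⌋₊, Finset.mem_image.2 ⟨_, ?_, rfl⟩, N * t - ⌊N * t⌋₊,
        ⟨sub_nonneg.2 hfl, ?_⟩, ?_⟩
      · rw [Finset.mem_range, Nat.floor_lt (mul_nonneg hN0.le ht.1)]
        push_cast
        rw [← hN]
        exact mul_lt_of_lt_one_right hN0 ht.2
      · linarith [Nat.lt_floor_add_one (N * t)]
      · rw [smul_eq_mul, ← mul_add, add_sub_cancel, inv_mul_cancel_left₀ hN0.ne']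
    · intro a ha a' ha' t ht t' ht' h
      obtain ⟨k, -, rfl⟩ := Finset.mem_image.1 ha
      obtain ⟨k', -, rfl⟩ := Finset.mem_image.1 ha'
      rw [smul_eq_mul, smul_eq_mul, ← mul_add, ← mul_add] at h
      have h' : (k : ℝ) + t = k' + t' := mul_left_cancel₀ (by positivity) h
      have h1 : (k : ℝ) < k' + 1 := by linarith [ht.1, ht'.2]
      have h2 : (k' : ℝ) < k + 1 := by linarith [ht'.1, ht.2]
      have h3 : k = k' := by
        have h1' : k < k' + 1 := by exact_mod_cast h1
        have h2' : k' < k + 1 := by exact_mod_cast h2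
        omega
      rw [h3]

/-- This ball is `ℤ_p`, the disjoint union of its residue classes modulo `p ^ n`, with
representatives `0, …, p ^ n - 1`. -/
theorem isSelfSimilar_padic (p : ℕ) [hp : Fact p.Prime] :
    IsSelfSimilar ℚ_[p] (Metric.closedBall (0 : ℚ_[p]) 1) where
  zero_mem := by simp
  measurableSet := measurableSet_closedBall
  isBounded := Metric.isBounded_closedBall
  interior_nonempty := ⟨0, Metric.ball_subset_interior_closedBall (Metric.mem_ball_self one_pos)⟩
  exists_partition := by
    classical
    intro η hη
    obtain ⟨n, hn⟩ := PadicInt.exists_pow_neg_lt p hη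
    have hp0 : (p : ℚ_[p]) ≠ 0 := by exact_mod_cast hp.out.ne_zero
    have hs : ‖(p : ℚ_[p]) ^ n‖ = (p : ℝ) ^ (-n : ℤ) := by simp
    refine ⟨(p : ℚ_[p]) ^ n, pow_ne_zero _ hp0, hs ▸ hn,
      (Finset.range (p ^ n)).image fun k : ℕ => (k : ℚ_[p]), ?_, ?_, ?_⟩
    · intro a ha t ht
      obtain ⟨k, -, rfl⟩ := Finset.mem_image.1 ha
      rw [mem_closedBall_zero_iff] at ht ⊢
      obtain ⟨t, rfl⟩ : ∃ z : ℤ_[p], (z : ℚ_[p]) = t := ⟨⟨t, ht⟩, rfl⟩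
      exact_mod_cast PadicInt.norm_le_one ((k : ℤ_[p]) + (p : ℤ_[p]) ^ n * t)
    · intro t ht
      rw [mem_closedBall_zero_iff] at ht
      obtain ⟨t, rfl⟩ : ∃ z : ℤ_[p], (z : ℚ_[p]) = t := ⟨⟨t, ht⟩, rfl⟩
      obtain ⟨k, hk⟩ : ∃ k : ℕ, k < p ^ n ∧
          (t - (k : ℤ_[p])) ∈ Ideal.span {(p : ℤ_[p]) ^ n} :=
        ⟨_, PadicInt.appr_lt _ _, PadicInt.appr_spec n t⟩
      obtain ⟨w, hw⟩ := Ideal.mem_span_singleton.1 hk.2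
      refine ⟨k, Finset.mem_image.2 ⟨k, Finset.mem_range.2 hk.1, rfl⟩, w,
        by rw [mem_closedBall_zero_iff]; exact w.2, ?_⟩
      have := congrArg (fun z : ℤ_[p] => (z : ℚ_[p])) hw
      push_cast at this
      rw [smul_eq_mul, ← this]
      ring
    · intro a ha a' ha' t ht t' ht' h
      obtain ⟨k, hk, rfl⟩ := Finset.mem_image.1 ha
      obtain ⟨k', hk', rfl⟩ := Finset.mem_image.1 ha'
      rw [mem_closedBall_zero_iff] at ht ht'
      obtain ⟨t, rfl⟩ : ∃ z : ℤ_[p], (z : ℚ_[p]) = t := ⟨⟨t, ht⟩, rfl⟩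
      obtain ⟨t', rfl⟩ : ∃ z : ℤ_[p], (z : ℚ_[p]) = t' := ⟨⟨t', ht'⟩, rfl⟩
      have hdiv : ((p ^ n : ℕ) : ℤ_[p]) ∣ ((k - k' : ℤ) : ℤ_[p]) := by
        refine ⟨t' - t, Subtype.ext ?_⟩
        push_cast
        rw [smul_eq_mul, smul_eq_mul] at h
        linear_combination h
      have hmod : ((p ^ n : ℕ) : ℤ) ∣ (k - k' : ℤ) := by
        have := (PadicInt.norm_int_le_pow_iff_dvd (p := p) (k := (k - k' : ℤ)) (n := n)).1 ?_
        · exact_mod_cast this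
        · rw [PadicInt.norm_le_pow_iff_mem_span_pow, Ideal.mem_span_singleton]
          exact_mod_cast hdiv
      have hkk : k = k' := by
        rw [Finset.mem_range] at hk hk'
        have hlt : |(k - k' : ℤ)| < ((p ^ n : ℕ) : ℤ) := by rw [abs_lt]; omega
        have := Int.eq_zero_of_abs_lt_dvd hmod hlt
        omega
      rw [hkk]

end SelfSimilarSets

/-! ### Choice of the exponents, and application to the functions and their gradients. -/

section LocalGoodness

open MeasureTheory

variable {𝕜 : Type*} [NontriviallyNormedField 𝕜] [CompleteSpace 𝕜] [ProperSpace 𝕜]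
  [MeasurableSpace 𝕜] [BorelSpace 𝕜] {q : ℝ≥0∞} [Fact (1 ≤ q)] {d n : ℕ}

theorem measurable_restrict_of_continuousOn {X E : Type*} [TopologicalSpace X] [MeasurableSpace X]
    [BorelSpace X] [TopologicalSpace E] {F : X → E} {V : Set X}
    (hF : ContinuousOn F V) : @Measurable V E _ (borel E) fun x => F x := by
  let : MeasurableSpace E := borel E
  have : BorelSpace E := ⟨rfl⟩
  exact (continuousOn_iff_continuous_domRestrict.1 hF).measurable

/-- Take `l = k + 1` with `k` above `1 / α` and `1 / β`; then `l - 1 = k ≥ 1`, so the second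
exponent has a nonzero denominator. -/
theorem exists_exponent (hd : 0 < d) {α β : ℝ} (hα : 0 < α) (hβ : 0 < β) :
    ∃ l : ℕ, 2 ≤ l ∧ 0 < 1 / ((d : ℝ) * l) ∧ 1 / ((d : ℝ) * l) ≤ α ∧
      0 < 1 / ((d : ℝ) * ((l : ℝ) - 1)) ∧ 1 / ((d : ℝ) * ((l : ℝ) - 1)) ≤ β := by
  obtain ⟨k, hk⟩ := exists_nat_gt (max (1 / α) (1 / β))
  have hk1 : 1 / α < k := (le_max_left _ _).trans_lt hk
  have hk2 : 1 / β < k := (le_max_right _ _).trans_lt hk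
  have hd1 : (1 : ℝ) ≤ d := by exact_mod_cast hd
  have hk0 : (0 : ℝ) < k := (by positivity : (0 : ℝ) < 1 / α).trans hk1
  have hα' : 1 < k * α := by rwa [div_lt_iff₀ hα] at hk1
  have hβ' : 1 < k * β := by rwa [div_lt_iff₀ hβ] at hk2
  have hkd : (k : ℝ) ≤ d * k := le_mul_of_one_le_left hk0.le hd1
  have hk1' : 1 ≤ k := by exact_mod_cast hk0
  have e : ((k + 1 : ℕ) : ℝ) - 1 = k := by push_cast; ring
  refine ⟨k + 1, by omega, by positivity, ?_, ?_, ?_⟩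
  · rw [div_le_iff₀ (by positivity)]
    push_cast
    nlinarith
  · rw [e]; positivity
  · rw [e, div_le_iff₀ (by positivity)]
    nlinarith

/-- Near any point, the functions `a₀ + a · f + Θ` and the norms of their gradients are good,
uniformly in the coefficients. -/
theorem exists_good_add_linear_combination [MeasurableSpace (PiLp q fun _ : Fin d => 𝕜)]
    [BorelSpace (PiLp q fun _ : Fin d => 𝕜)] (hd : 0 < d)
    (μ : Measure (PiLp q fun _ : Fin d => 𝕜)) [μ.IsAddHaarMeasure] {D : Set 𝕜}
    (hD : IsSelfSimilar 𝕜 D) {U : Set (PiLp q fun _ : Fin d => 𝕜)}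
    {x₀ : PiLp q fun _ : Fin d => 𝕜}
    {f : (PiLp q fun _ : Fin d => 𝕜) → PiLp q fun _ : Fin n => 𝕜}
    {Θ : (PiLp q fun _ : Fin d => 𝕜) → 𝕜} (hU : IsOpen U) (hx₀ : x₀ ∈ U)
    (hf : AnalyticOnNhd 𝕜 f U) (hΘ : AnalyticOnNhd 𝕜 Θ U) :
    ∃ V : Set (PiLp q fun _ : Fin d => 𝕜), IsOpen V ∧ x₀ ∈ V ∧ V ⊆ U ∧
      ∃ (C : ℝ) (l : ℕ), 0 < C ∧ 2 ≤ l ∧ ∀ (a₀ : 𝕜) (a : Fin n → 𝕜),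
        IsGoodOn C (1 / ((d : ℝ) * l)) (fun x => a₀ + ∑ j, a j * f x j + Θ x) V μ ∧
        IsGoodOn C (1 / ((d : ℝ) * ((l : ℝ) - 1)))
          (fun x => ‖grad (fun y => ∑ j, a j * f y j + Θ y) x‖) V μ := by
  let X := PiLp q fun _ : Fin d => 𝕜
  let e : X ≃L[𝕜] (Fin d → 𝕜) := PiLp.continuousLinearEquiv q 𝕜 fun _ => 𝕜
  have hfj : ∀ j, AnalyticOnNhd 𝕜 (fun x => f x j) U := fun j =>
    (PiLp.proj (𝕜 := 𝕜) q (fun _ : Fin n => 𝕜) j).comp_analyticOnNhd hf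
  let v : Fin d → X := fun i => WithLp.toLp q (Pi.single i 1)
  have hder : ∀ (φ : X → 𝕜), AnalyticOnNhd 𝕜 φ U → ∀ i,
      AnalyticOnNhd 𝕜 (fun x => fderiv 𝕜 φ x (v i)) U := fun φ hφ i =>
    (ContinuousLinearMap.apply 𝕜 𝕜 (v i)).comp_analyticOnNhd hφ.fderiv
  -- Treating `Θ` as one more function with coefficient `1` makes the inhomogeneous family part of a
  -- linear one, with coefficient vector `(a₀, 1, a)`.
  let g₁ : Fin 1 → Fin (n + 2) → X → 𝕜 := fun _ =>
    Fin.cons (fun _ => 1) (Fin.cons Θ fun j x => f x j)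
  have hg₁ : ∀ i j, AnalyticAt 𝕜 (g₁ i j) x₀ := by
    intro i j
    refine Fin.cases ?_ (fun j => Fin.cases ?_ (fun j => ?_) j) j
    · exact analyticAt_const
    · exact hΘ x₀ hx₀
    · exact hfj j x₀ hx₀
  -- Row `i` yields the `i`-th partial derivative. All rows share the coefficient vector `(1, a)`,
  -- and the gradient norm is comparable with the maximum over the rows.
  let g₂ : Fin d → Fin (n + 1) → X → 𝕜 := fun i =>
    Fin.cons (fun x => fderiv 𝕜 Θ x (v i)) fun j x => fderiv 𝕜 (fun y => f y j) x (v i)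
  have hg₂ : ∀ i j, AnalyticAt 𝕜 (g₂ i j) x₀ := by
    intro i j
    refine Fin.cases (hder Θ hΘ i x₀ hx₀) (fun j => hder _ (hfj j) i x₀ hx₀) j
  obtain ⟨Λ, hΛ, hΛ'⟩ : ∃ K : ℝ, 1 ≤ K ∧ ∀ w, ‖e.symm w‖ ≤ K * ‖w‖ := by
    obtain ⟨K, -, hK⟩ := (e.symm : (Fin d → 𝕜) →L[𝕜] X).bound
    exact ⟨max K 1, le_max_right _ _, fun w => (hK w).trans (by gcongr; exact le_max_left _ _)⟩
  obtain ⟨ρ₁, C₁, α₁, hρ₁, hC₁, hα₁, H₁⟩ :=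
    exists_good_of_comparable one_pos hd e (μ := μ) hg₁ hD le_rfl
  obtain ⟨ρ₂, C₂, α₂, hρ₂, hC₂, hα₂, H₂⟩ :=
    exists_good_of_comparable hd hd e (μ := μ) hg₂ hD hΛ
  obtain ⟨l, hl, h1, h1', h2, h2'⟩ := exists_exponent hd hα₁ hα₂
  obtain ⟨ρ₃, hρ₃, hρU⟩ := Metric.isOpen_iff.1 hU x₀ hx₀
  set V := Metric.ball x₀ (min ρ₃ (min ρ₁ ρ₂)) with hV
  have hV₁ : V ⊆ Metric.ball x₀ ρ₁ :=
    Metric.ball_subset_ball ((min_le_right _ _).trans (min_le_left _ _))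
  have hV₂ : V ⊆ Metric.ball x₀ ρ₂ :=
    Metric.ball_subset_ball ((min_le_right _ _).trans (min_le_right _ _))
  have hVU : V ⊆ U := (Metric.ball_subset_ball (min_le_left _ _)).trans hρU
  refine ⟨V, Metric.isOpen_ball, Metric.mem_ball_self (by positivity), hVU, max C₁ C₂, l,
    by positivity, hl, fun a₀ a => ⟨⟨?_, ?_⟩, ⟨?_, ?_⟩⟩⟩
  · have hΘc := hΘ.continuousOn.mono hVU
    have hfc := fun j : Fin n => (hfj j).continuousOn.mono hVU
    have hc : ContinuousOn (fun x => a₀ + ∑ j, a j * f x j + Θ x) V := by fun_prop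
    exact measurable_restrict_of_continuousOn hc
  · intro x _ r hr hB ε hε
    have hsum : ∀ (i : Fin 1) y,
        ∑ j, (Fin.cons a₀ (Fin.cons 1 a) : Fin (n + 2) → 𝕜) j * g₁ i j y =
          a₀ + ∑ j, a j * f y j + Θ y := by
      intro i y
      simp only [g₁, Fin.sum_univ_succ, Fin.cons_zero, Fin.cons_succ]
      ring
    refine (H₁ _ h1 h1' (Fin.cons a₀ (Fin.cons 1 a)) _ x r hr (hB.trans hV₁)
      (fun y _ i => (congrArg norm (hsum i y)).le)
      (fun y _ => ⟨0, by rw [one_mul, hsum 0 y]⟩) ε hε).trans ?_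
    gcongr
    exact le_max_left _ _
  · refine measurable_restrict_of_continuousOn (ContinuousOn.norm ?_)
    have hφ : AnalyticOnNhd 𝕜 (fun y => ∑ j, a j * f y j + Θ y) U := by
      refine AnalyticOnNhd.add ?_ hΘ
      exact Finset.analyticOnNhd_fun_sum _ fun j _ => analyticOnNhd_const.mul (hfj j)
    refine e.symm.continuous.comp_continuousOn (continuousOn_pi.2 fun i => ?_)
    exact (hder _ hφ i).continuousOn.mono hVU
  · intro x _ r hr hB ε hε
    have hcomp : ∀ y ∈ Metric.ball x r, ∀ i,
        ∑ j, (Fin.cons 1 a : Fin (n + 1) → 𝕜) j * g₂ i j y =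
          grad (fun y => ∑ j, a j * f y j + Θ y) y i := by
      intro y hy i
      have hyU := hVU (hB hy)
      have hd₁ : ∀ j, DifferentiableAt 𝕜 (fun y => f y j) y := fun j =>
        (hfj j y hyU).differentiableAt
      have hd₂ : DifferentiableAt 𝕜 Θ y := (hΘ y hyU).differentiableAt
      have hF : fderiv 𝕜 (fun y => ∑ j, a j * f y j + Θ y) y =
          ∑ j, a j • fderiv 𝕜 (fun y => f y j) y + fderiv 𝕜 Θ y := by
        refine HasFDerivAt.fderiv (HasFDerivAt.add ?_ hd₂.hasFDerivAt)
        exact HasFDerivAt.fun_sum fun j _ => (hd₁ j).hasFDerivAt.const_mul (a j)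
      simp only [grad, hF, g₂, Fin.sum_univ_succ, Fin.cons_zero, Fin.cons_succ, one_mul]
      simp [v, add_comm]
    refine (H₂ _ h2 h2' (Fin.cons 1 a) _ x r hr (hB.trans hV₂) (fun y hy i => ?_) (fun y hy => ?_)
      ε hε).trans ?_
    · rw [hcomp y hy i, norm_norm]
      exact PiLp.norm_apply_le _ i
    · set w := grad (fun y => ∑ j, a j * f y j + Θ y) y
      have : Nonempty (Fin d) := ⟨⟨0, hd⟩⟩
      obtain ⟨i, hi⟩ := Finite.exists_max fun i => ‖w i‖
      refine ⟨i, ?_⟩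
      rw [hcomp y hy i, norm_norm]
      calc ‖w‖ = ‖e.symm (e w)‖ := by rw [e.symm_apply_apply]
        _ ≤ Λ * ‖e w‖ := hΛ' _
        _ ≤ Λ * ‖w i‖ := by
            gcongr
            exact (pi_norm_le_iff_of_nonneg (norm_nonneg _)).2 hi
    · gcongr
      exact le_max_right _ _

end LocalGoodness

/-! ### The theorem at the infinite and the finite places. -/

/-- The two conjuncts treat the infinite place (`ℚ_∞ = ℝ`, Euclidean norms, Lebesgue measure,
coefficients in `ℝ`) and the finite places (`ℚ_p`, maximum norms, Haar measure, coefficients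
in `ℤ_p`). -/
theorem corollary3p4 :
    (∀ (d n : ℕ), 0 < d →
      ∀ (U : Set (EuclideanSpace ℝ (Fin d))) (x₀ : EuclideanSpace ℝ (Fin d))
        (f : EuclideanSpace ℝ (Fin d) → EuclideanSpace ℝ (Fin n))
        (Θ : EuclideanSpace ℝ (Fin d) → ℝ),
      IsOpen U → x₀ ∈ U →
      AnalyticUpToBoundary (𝕜 := ℝ) f U → IndependentOnOpens f U → NormalizedOn f U →
      AnalyticUpToBoundary (𝕜 := ℝ) Θ U → NormalizedOn Θ U →
      ∃ V : Set (EuclideanSpace ℝ (Fin d)), IsOpen V ∧ x₀ ∈ V ∧ V ⊆ U ∧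
        ∃ (C : ℝ) (l : ℕ), 0 < C ∧ 2 ≤ l ∧ ∀ (a₀ : ℝ) (a : Fin n → ℝ),
          IsGoodOn C (1 / ((d : ℝ) * l)) (fun x => a₀ + ∑ j, a j * f x j + Θ x) V
            MeasureTheory.volume ∧
          IsGoodOn C (1 / ((d : ℝ) * ((l : ℝ) - 1)))
            (fun x => ‖grad (fun y => ∑ j, a j * f y j + Θ y) x‖) V MeasureTheory.volume) ∧
    (∀ (p : ℕ) [Fact p.Prime] (d n : ℕ), 0 < d →
      ∀ (μ : MeasureTheory.Measure (PiLp ∞ (fun _ : Fin d => ℚ_[p]))) [μ.IsAddHaarMeasure]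
        (U : Set (PiLp ∞ (fun _ : Fin d => ℚ_[p]))) (x₀ : PiLp ∞ (fun _ : Fin d => ℚ_[p]))
        (f : PiLp ∞ (fun _ : Fin d => ℚ_[p]) → PiLp ∞ (fun _ : Fin n => ℚ_[p]))
        (Θ : PiLp ∞ (fun _ : Fin d => ℚ_[p]) → ℚ_[p]),
      IsOpen U → x₀ ∈ U →
      AnalyticUpToBoundary (𝕜 := ℚ_[p]) f U → IndependentOnOpens f U → NormalizedOn f U →
      AnalyticUpToBoundary (𝕜 := ℚ_[p]) Θ U → NormalizedOn Θ U →
      ∃ V : Set (PiLp ∞ (fun _ : Fin d => ℚ_[p])), IsOpen V ∧ x₀ ∈ V ∧ V ⊆ U ∧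
        ∃ (C : ℝ) (l : ℕ), 0 < C ∧ 2 ≤ l ∧ ∀ (a₀ : ℤ_[p]) (a : Fin n → ℤ_[p]),
          IsGoodOn C (1 / ((d : ℝ) * l))
            (fun x => (a₀ : ℚ_[p]) + ∑ j, (a j : ℚ_[p]) * f x j + Θ x) V μ ∧
          IsGoodOn C (1 / ((d : ℝ) * ((l : ℝ) - 1)))
            (fun x => ‖grad (fun y => ∑ j, (a j : ℚ_[p]) * f y j + Θ y) x‖) V μ) := by

  refine ⟨fun d n hd U x₀ f Θ hU hx₀ hf _ _ hΘ _ => ?_,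
    fun p _ d n hd μ _ U x₀ f Θ hU hx₀ hf _ _ hΘ _ => ?_⟩
  · exact exists_good_add_linear_combination hd MeasureTheory.volume isSelfSimilar_Ico hU hx₀
      hf.1 hΘ.1
  · obtain ⟨V, hV, hxV, hVU, C, l, hC, hl, H⟩ :=
      exists_good_add_linear_combination hd μ (isSelfSimilar_padic p) hU hx₀ hf.1 hΘ.1
    -- The estimate is uniform over all coefficients in `ℚ_p`, in particular over those in `ℤ_p`.
    exact ⟨V, hV, hxV, hVU, C, l, hC, hl, fun a₀ a => H a₀ fun j => a j⟩
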